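/- Let $N\ge 1$ and let $\theta(n)=1,\tfrac12,0$ for $n>0$, $n=0$, $n<0$. Put $r_{12}=2\sum_{i,j}\theta(i-j)\,E_{ij}\otimes E_{ji}$, and let ${}^{t_1},{}^{t_2}$ denote transposition in the first and second tensor factor. For a matrix $M$ write $M_1=M\otimes 1$, $M_2=1\otimes M$, and let $\{X\overset{\otimes}{,}Y\}=\sum\{x_{ij},y_{kl}\}\,E_{ij}\otimes E_{kl}$. On the space of triples $(\mathbb A,B,C)$, where $\mathbb A$ is a complex $N\times N$ matrix and $B,C\in GL_N(\mathbb C)$, consider the type-(ii) bracket: the antisymmetric biderivation on functions with $$\{\mathbb A\overset{\otimes}{,}\mathbb A\}=r_{12}(\mathbb A\otimes\mathbb A)-(\mathbb A\otimes\mathbb A)r_{12}+\mathbb A_1r_{12}^{t_1}\mathbb A_2-\mathbb A_2r_{12}^{t_1}\mathbb A_1,$$ $$\{X\overset{\otimes}{,}Y\}=r_{12}(X\otimes Y)-(X\otimes Y)r_{12}\quad\text{for }(X,Y)=(B,B),(C,C),(C,B),$$ $$\{X\overset{\otimes}{,}\mathbb A\}=-X_1r_{12}^{t_2}\mathbb A_2-X_1\mathbb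 A_2r_{12}\quad\text{for }X=B,C.$$ A Casimir function on an open set is a holomorphic function on it whose bracket with every holomorphic function vanishes. **Theorem.** The following $2[N/2]+N$ functions are Casimir functions, each on the set of triples where the denominators in its defining formula do not vanish. * The $[N/2]$ coefficients $Y_p$ of the expansion, valid for all $\lambda\neq0$ where $\det\mathbb A\ne0$, $$\frac{\det(\lambda\mathbb A+\lambda^{-1}\mathbb A^{T})}{\det\mathbb A}=(\lambda^N+\lambda^{-N})+\sum_{p=1}^{[N/2]}(\lambda^{N-2p}+\lambda^{2p-N})\,Y_p.$$ * The $[N/2]$ functions $$X_p=\frac{M_S^pM_S^{N-p}}{M_C^{N-p}M_C^p}\cdot\frac{\det B\,\det C}{\det\mathbb A},\qquad p=1,\dots,[N/2],$$ where $M_S^q$ is the upper-left $q\times q$ minor of $S=\mathbb A^{T}B^{-1}$ and $M_C^q$ is the upper-right $q\times q$ minor of $C$ (first $q$ rows, last $q$ columns). * The $N$ coefficients $Z_p$ of the expansion $$\frac{\det(B+\lambda C)}{\det B}=1+\sum_{p=1}^{N}\lambda^pZ_p .$$ Moreover, these $2[N/2]+N$ functions are algebraically independent over $\mathbb C$, as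 functions on the set of triples for which $\mathbb A,B,C$ are invertible and all upper-right minors of $C$ are nonzero. -/

import Mathlib

open scoped Matrix Kronecker

noncomputable section

namespace PoissonTriple

/-- Index set of the coordinate functions on triples of `N × N` matrices:
`(0, i, j)` is the entry `a_{ij}` of `𝔸`, `(1, i, j)` is `b_{ij}`, `(2, i, j)` is `c_{ij}`. -/
abbrev Entry (N : ℕ) : Type := Fin 3 × Fin N × Fin N

/-- A point is a triple `(𝔸, B, C)` of complex `N × N` matrices, given by all its entries. -/
abbrev Point (N : ℕ) : Type := Entry N → ℂ

/-- The bilinear form `𝔸` of a triple. -/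
def matA {N : ℕ} (x : Point N) : Matrix (Fin N) (Fin N) ℂ := Matrix.of fun i j => x (0, i, j)

/-- The matrix `B` of a triple. -/
def matB {N : ℕ} (x : Point N) : Matrix (Fin N) (Fin N) ℂ := Matrix.of fun i j => x (1, i, j)

/-- The matrix `C` of a triple. -/
def matC {N : ℕ} (x : Point N) : Matrix (Fin N) (Fin N) ℂ := Matrix.of fun i j => x (2, i, j)

/-- Operators on `ℂ^N ⊗ ℂ^N`: the entry at `((i, k), (j, l))` is the coefficient of
`E_{ij} ⊗ E_{kl}`. -/
abbrev Tensor (N : ℕ) : Type := Matrix (Fin N × Fin N) (Fin N × Fin N) ℂ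

/-- `θ(i - j)`, which is `1`, `1/2` or `0` according to the sign of `i - j`. -/
def theta {N : ℕ} (i j : Fin N) : ℂ := if j < i then 1 else if i = j then 1 / 2 else 0

/-- The trigonometric classical `r`-matrix `r₁₂ = 2 ∑_{i,j} θ(i - j) E_{ij} ⊗ E_{ji}`. -/
def rMatrix (N : ℕ) : Tensor N :=
  ∑ i : Fin N, ∑ j : Fin N,
    (2 * theta i j) • (Matrix.single i j (1 : ℂ) ⊗ₖ Matrix.single j i (1 : ℂ))

/-- Transposition in the first tensor factor. -/
def transpose₁ {N : ℕ} (M : Tensor N) : Tensor N :=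
  Matrix.of fun u v => M (v.1, u.2) (u.1, v.2)

/-- Transposition in the second tensor factor. -/
def transpose₂ {N : ℕ} (M : Tensor N) : Tensor N :=
  Matrix.of fun u v => M (u.1, v.2) (v.1, u.2)

/-- Exchange of the two tensor factors. -/
def swapFactors {N : ℕ} (M : Tensor N) : Tensor N :=
  Matrix.of fun u v => M (u.2, u.1) (v.2, v.1)

/-- `X` acting in the first tensor factor. -/
def in₁ {N : ℕ} (X : Matrix (Fin N) (Fin N) ℂ) : Tensor N := X ⊗ₖ 1

/-- `X` acting in the second tensor factor. -/
def in₂ {N : ℕ} (X : Matrix (Fin N) (Fin N) ℂ) : Tensor N := 1 ⊗ₖ X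

/-- The bracket `{𝔸 ⊗ 𝔸} = r₁₂ (𝔸 ⊗ 𝔸) - (𝔸 ⊗ 𝔸) r₁₂ + 𝔸₁ r₁₂^{t₁} 𝔸₂ - 𝔸₂ r₁₂^{t₁} 𝔸₁` of the
entries of a bilinear form. -/
def bracketForm {N : ℕ} (A : Matrix (Fin N) (Fin N) ℂ) : Tensor N :=
  rMatrix N * (A ⊗ₖ A) - (A ⊗ₖ A) * rMatrix N
    + in₁ A * transpose₁ (rMatrix N) * in₂ A - in₂ A * transpose₁ (rMatrix N) * in₁ A

/-- The Lie--Poisson bracket `{X ⊗ Y} = r₁₂ (X ⊗ Y) - (X ⊗ Y) r₁₂`. -/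
def bracketGroup {N : ℕ} (X Y : Matrix (Fin N) (Fin N) ℂ) : Tensor N :=
  rMatrix N * (X ⊗ₖ Y) - (X ⊗ₖ Y) * rMatrix N

/-- The matrix `Q₁₂ = - r₁₂^{t₂}` of the type (ii) bracket. -/
def typeIIMatrix (N : ℕ) : Tensor N := -transpose₂ (rMatrix N)

/-- The bracket `{X ⊗ 𝔸} = X₁ Q₁₂ 𝔸₂ + X₁ 𝔸₂ Q₁₂^{t₂}` with `Q₁₂` of type (ii). -/
def bracketMixed {N : ℕ} (X A : Matrix (Fin N) (Fin N) ℂ) : Tensor N :=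
  in₁ X * typeIIMatrix N * in₂ A + in₁ X * in₂ A * transpose₂ (typeIIMatrix N)

/-- All brackets of the matrices of a triple, in the order `𝔸, B, C`. The entry in row `X` and
column `Y` is `{X ⊗ Y}`; the brackets `{𝔸 ⊗ B}`, `{𝔸 ⊗ C}`, `{B ⊗ C}` are the ones that
antisymmetry dictates from `{B ⊗ 𝔸}`, `{C ⊗ 𝔸}`, `{C ⊗ B}`. -/
def bracketTensor {N : ℕ} (x : Point N) : Fin 3 → Fin 3 → Tensor N
  | 0, 0 => bracketForm (matA x)
  | 0, 1 => -swapFactors (bracketMixed (matB x) (matA x))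
  | 0, 2 => -swapFactors (bracketMixed (matC x) (matA x))
  | 1, 0 => bracketMixed (matB x) (matA x)
  | 1, 1 => bracketGroup (matB x) (matB x)
  | 1, 2 => -swapFactors (bracketGroup (matC x) (matB x))
  | 2, 0 => bracketMixed (matC x) (matA x)
  | 2, 1 => bracketGroup (matC x) (matB x)
  | 2, 2 => bracketGroup (matC x) (matC x)

/-- The value at `x` of the bracket `{u, v}` of two coordinate functions. -/
def coordBracket {N : ℕ} (x : Point N) (u v : Entry N) : ℂ :=
  bracketTensor x u.1 v.1 (u.2.1, v.2.1) (u.2.2, v.2.2)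

/-- The type (ii) bracket of two functions of the triple:
`{f, g} = ∑_{u,v} (∂f/∂u) (∂g/∂v) {u, v}`, the sum over all pairs of coordinates. -/
def poissonBracket {N : ℕ} (f g : Point N → ℂ) (x : Point N) : ℂ :=
  ∑ u : Entry N, ∑ v : Entry N,
    fderiv ℂ f x (Pi.single u 1) * fderiv ℂ g x (Pi.single v 1) * coordBracket x u v

/-- `f` is a Casimir function on the open set `U`: it is holomorphic there and its bracket with
every holomorphic function vanishes. -/
def IsCasimirOn {N : ℕ} (U : Set (Point N)) (f : Point N → ℂ) : Prop :=
  IsOpen U ∧ DifferentiableOn ℂ f U ∧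
    ∀ g : Point N → ℂ, DifferentiableOn ℂ g U → ∀ x ∈ U, poissonBracket f g x = 0

/-- The space `𝒜 × GL_N × GL_N` of triples: `B` and `C` are invertible. -/
def tripleSpace (N : ℕ) : Set (Point N) :=
  {x | (matB x).det ≠ 0 ∧ (matC x).det ≠ 0}

/-- The triples with a nondegenerate form `𝔸`. -/
def nondegenerateTriples (N : ℕ) : Set (Point N) :=
  {x ∈ tripleSpace N | (matA x).det ≠ 0}

/-- The upper-left `q × q` minor. -/
def upperLeftMinor {N : ℕ} (M : Matrix (Fin N) (Fin N) ℂ) (q : ℕ) (hq : q ≤ N) : ℂ :=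
  (M.submatrix (Fin.castLE hq) (Fin.castLE hq)).det

/-- The upper-right `q × q` minor: the first `q` rows and the last `q` columns. -/
def upperRightMinor {N : ℕ} (M : Matrix (Fin N) (Fin N) ℂ) (q : ℕ) (hq : q ≤ N) : ℂ :=
  (M.submatrix (Fin.castLE hq) fun j : Fin q => (⟨N - q + j, by omega⟩ : Fin N)).det

/-- The matrix `S = 𝔸ᵀ B⁻¹`. -/
def matS {N : ℕ} (x : Point N) : Matrix (Fin N) (Fin N) ℂ := (matA x)ᵀ * (matB x)⁻¹

/-- The function `X_p = M_S^p M_S^{N-p} / (M_C^{N-p} M_C^p) · det B det C / det 𝔸`. -/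
def casimirX {N : ℕ} (p : ℕ) (hp : p ≤ N) (x : Point N) : ℂ :=
  upperLeftMinor (matS x) p hp * upperLeftMinor (matS x) (N - p) (Nat.sub_le N p)
      / (upperRightMinor (matC x) (N - p) (Nat.sub_le N p) * upperRightMinor (matC x) p hp)
    * ((matB x).det * (matC x).det / (matA x).det)

/-- The domain of `X_p`: no denominator vanishes. -/
def domainX (N p : ℕ) (hp : p ≤ N) : Set (Point N) :=
  {x ∈ nondegenerateTriples N | upperRightMinor (matC x) p hp ≠ 0 ∧
    upperRightMinor (matC x) (N - p) (Nat.sub_le N p) ≠ 0}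

/-- The common domain: `𝔸`, `B`, `C` are invertible and no upper-right minor of `C` vanishes. -/
def regularTriples (N : ℕ) : Set (Point N) :=
  {x ∈ nondegenerateTriples N | ∀ (q : ℕ) (hq : q ≤ N), upperRightMinor (matC x) q hq ≠ 0}

/-- For `p : Fin (N / 2)` the label `p + 1` runs through `1, …, [N/2]`. -/
theorem label_le {N : ℕ} (p : Fin (N / 2)) : (p : ℕ) + 1 ≤ N := by omega

end PoissonTriple

end

open PoissonTriple

/-! ### Logarithmic derivatives -/

/-! The bracket is a biderivation, so a function is Casimir once its derivative along the
Hamiltonian field of every matrix entry vanishes (`poissonBracket_eq_sum`). These fields move `𝔸` by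
infinitesimal congruences and `B`, `C` by left and right multiplications, and a determinant then
changes by the factor `tr L + tr R` (`fderiv_det_of_apply`). Working with logarithmic derivatives
makes products and quotients additive without asking the minors of `S` to be nonzero.

The congruence moving `𝔸` also moves `𝔸ᵀ`, and one pair of generators can be chosen for both `B` and
`C` (`hamiltonianVector_two_pencil` is the nontrivial case). Hence the factors of `det (s𝔸 + t𝔸ᵀ)`
and `det (B + tC)` do not depend on the parameters, and all coefficients of the normalised
determinants are constant along the fields. For `X_p`, the fields act on `S` by a lower triangular
matrix on the left and an upper triangular one on the right, and on `C` by lower triangular matrices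
on both sides. Such actions rescale the minors in question by partial traces, and the weights from
`p` and `N - p` complement each other and cancel against the determinants
(`hasLogDerivAt_casimirX_of_fields`).

For independence, every value vector whose `X`-entries and last `Z`-entry are nonzero is attained
(`exists_regular_point_of_values`). The point has `C` equal to the flip, and `𝔸` and `B⁻¹` upper
triangular and supported on the two diagonals. Determinants split into `2 × 2` blocks: the
antidiagonal of `𝔸` controls `Y`, while products and ratios of paired diagonal entries of `B⁻¹`,
with its antidiagonal, control `Z` and `X`. A polynomial relation therefore vanishes off a
hypersurface, so it is zero. -/

/-- `f` is differentiable at `x` and its derivative in direction `h` is `c * f x`. -/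
structure HasLogDerivAt {E : Type*} [NormedAddCommGroup E] [NormedSpace ℂ E]
    (f : E → ℂ) (x h : E) (c : ℂ) : Prop where
  differentiableAt : DifferentiableAt ℂ f x
  fderiv_apply : fderiv ℂ f x h = c * f x

section LogDeriv

variable {E : Type*} [NormedAddCommGroup E] [NormedSpace ℂ E] {f g : E → ℂ} {x h : E} {a b : ℂ}

theorem HasLogDerivAt.mul (hf : HasLogDerivAt f x h a) (hg : HasLogDerivAt g x h b) :
    HasLogDerivAt (fun y => f y * g y) x h (a + b) := by
  refine ⟨hf.1.mul hg.1, ?_⟩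
  rw [fderiv_fun_mul hf.1 hg.1]
  simp [hf.2, hg.2]
  ring

theorem HasLogDerivAt.inv (hf : HasLogDerivAt f x h a) (h0 : f x ≠ 0) :
    HasLogDerivAt (fun y => (f y)⁻¹) x h (-a) := by
  refine ⟨hf.1.inv h0, ?_⟩
  refine (DFunLike.congr_fun
    ((hasDerivAt_inv h0).comp_hasFDerivAt x hf.1.hasFDerivAt).fderiv h).trans ?_
  simp [hf.2]
  field_simp

theorem HasLogDerivAt.div (hf : HasLogDerivAt f x h a) (hg : HasLogDerivAt g x h b)
    (h0 : g x ≠ 0) : HasLogDerivAt (fun y => f y / g y) x h (a - b) := by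
  simpa only [div_eq_mul_inv, sub_eq_add_neg] using hf.mul (hg.inv h0)

theorem differentiable_det_of {n : Type*} [Fintype n] [DecidableEq n] :
    Differentiable ℂ fun m : n → n → ℂ => (Matrix.of m).det := by
  simp only [Matrix.det_apply, Matrix.of_apply]
  fun_prop

theorem DifferentiableAt.matrix_det {n : Type*} [Fintype n] [DecidableEq n]
    {M : E → Matrix n n ℂ} (hM : ∀ i j, DifferentiableAt ℂ (fun y => M y i j) x) :
    DifferentiableAt ℂ (fun y => (M y).det) x := by
  simp only [Matrix.det_apply]
  fun_prop

/-- The direction is tangent to the curve `(1 + sL) m (1 + sR)`, along which the determinant is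
multiplicative, and `det (1 + sX) = 1 + s tr X + O(s²)`. No invertibility of `m` is needed. -/
theorem fderiv_det_of_apply {n : Type*} [Fintype n] [DecidableEq n] (m L R : Matrix n n ℂ) :
    fderiv ℂ (fun m : n → n → ℂ => (Matrix.of m).det) m (L * m + m * R)
      = (L.trace + R.trace) * m.det := by
  have key : ∀ X : Matrix n n ℂ, HasDerivAt (fun s : ℂ => (1 + s • X).det) X.trace 0 := by
    intro X
    have h1 := ((hasDerivAt_id (0 : ℂ)).const_mul X.trace).const_add 1
    obtain ⟨q, hq⟩ : ∃ q : Polynomial ℂ, ∀ s : ℂ,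
        (1 + s • X).det = 1 + X.trace * s + q.eval s * s ^ 2 :=
      ⟨_, fun s => Matrix.det_one_add_smul s X⟩
    have h2 := (q.hasDerivAt 0).mul ((hasDerivAt_id (0 : ℂ)).pow 2)
    refine (h1.add h2).congr_deriv ?_ |>.congr_of_eventuallyEq (.of_forall fun s => ?_)
    · simp
    · simp [hq]
  have hγ : HasDerivAt
      (fun s : ℂ => (fun i j => ((1 + s • L) * m * (1 + s • R)) i j : n → n → ℂ))
      (fun i j => (L * m + m * R) i j) 0 := by
    refine hasDerivAt_pi.2 fun i => hasDerivAt_pi.2 fun j => ?_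
    have h1 := ((hasDerivAt_id (0 : ℂ)).mul_const ((L * m + m * R) i j)).const_add (m i j)
    have h2 := ((hasDerivAt_id (0 : ℂ)).pow 2).mul_const ((L * m * R) i j)
    refine (h1.add h2).congr_deriv ?_ |>.congr_of_eventuallyEq (.of_forall fun s => ?_)
    · simp
    · have : (1 + s • L) * m * (1 + s • R) = m + s • (L * m + m * R) + s ^ 2 • (L * m * R) := by
        simp only [add_mul, mul_add, one_mul, mul_one, Matrix.smul_mul, Matrix.mul_smul, smul_add,
          smul_smul, pow_two]
        abel
      simp [this, mul_add]
  have h0 : (fun i j => ((1 + (0 : ℂ) • L) * m * (1 + (0 : ℂ) • R)) i j) = (m : n → n → ℂ) := by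
    simp
  have h2 := (differentiable_det_of (n := n) m).hasFDerivAt
  rw [← h0] at h2
  have h3 := h2.comp_hasDerivAt 0 hγ
  rw [h0] at h3
  refine h3.unique ?_
  refine ((((key L).mul_const m.det).mul (key R))).congr_deriv ?_ |>.congr_of_eventuallyEq
    (.of_forall fun s => ?_)
  · simp
    ring
  · simp only [Function.comp_apply, Pi.mul_apply, ← Matrix.det_mul]
    rfl

/-- If the derivative of a submatrix is given by left and right multiplications that preserve the
selected rows and columns, its determinant has the corresponding partial traces as logarithmic
derivative. -/
theorem hasLogDerivAt_det_submatrix {m n : Type*} [Fintype n] [DecidableEq n] [Fintype m]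
    [DecidableEq m] {M : E → Matrix n n ℂ} {L R : Matrix n n ℂ} (r c : m → n)
    (hr : Function.Injective r) (hc : Function.Injective c)
    (hM : ∀ i j, DifferentiableAt ℂ (fun y => M y i j) x)
    (hd : ∀ i j, fderiv ℂ (fun y => M y i j) x h = (L * M x + M x * R) i j)
    (hL : ∀ i k, k ∉ Set.range r → L (r i) k = 0)
    (hR : ∀ k j, k ∉ Set.range c → R k (c j) = 0) :
    HasLogDerivAt (fun y => ((M y).submatrix r c).det) x h
      (∑ i, L (r i) (r i) + ∑ j, R (c j) (c j)) := by
  have hD : HasFDerivAt (fun y => (fun i j => M y (r i) (c j) : m → m → ℂ))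
      (ContinuousLinearMap.pi fun i => ContinuousLinearMap.pi fun j =>
        fderiv ℂ (fun y => M y (r i) (c j)) x) x :=
    hasFDerivAt_pi.2 fun i => hasFDerivAt_pi.2 fun j => (hM _ _).hasFDerivAt
  have h2 := ((differentiable_det_of (n := m) _).hasFDerivAt).comp x hD
  refine ⟨h2.differentiableAt, ?_⟩
  have h3 := fderiv_det_of_apply ((M x).submatrix r c) (L.submatrix r r) (R.submatrix c c)
  refine (DFunLike.congr_fun h2.fderiv h).trans (Eq.trans ?_ h3)
  simp only [ContinuousLinearMap.comp_apply]
  refine congrArg _ ?_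
  ext i j
  simp only [ContinuousLinearMap.pi_apply, hd, Matrix.add_apply, Matrix.mul_apply]
  change _ = ∑ k, L (r i) (r k) * M x (r k) (c j) + ∑ k, M x (r i) (c k) * R (c k) (c j)
  congr 1
  · refine (Fintype.sum_of_injective r hr _ _ ?_ ?_).symm
    · intro k hk; rw [hL i k hk, zero_mul]
    · intro k; rfl
  · refine (Fintype.sum_of_injective c hc _ _ ?_ ?_).symm
    · intro k hk; rw [hR k j hk, mul_zero]
    · intro k; rfl

theorem hasLogDerivAt_det {n : Type*} [Fintype n] [DecidableEq n]
    {M : E → Matrix n n ℂ} {L R : Matrix n n ℂ}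
    (hM : ∀ i j, DifferentiableAt ℂ (fun y => M y i j) x)
    (hd : ∀ i j, fderiv ℂ (fun y => M y i j) x h = (L * M x + M x * R) i j) :
    HasLogDerivAt (fun y => (M y).det) x h (L.trace + R.trace) :=
  hasLogDerivAt_det_submatrix id id Function.injective_id Function.injective_id hM hd
    (fun _ k hk => absurd ⟨k, rfl⟩ hk) (fun k _ hk => absurd ⟨k, rfl⟩ hk)

end LogDeriv

/-! ### Brackets of the matrix entries -/

theorem rMatrix_entry {N : ℕ} (i k j l : Fin N) :
    rMatrix N (i, k) (j, l) = if k = j ∧ l = i then 2 * theta i j else 0 := by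
  simp only [rMatrix, Matrix.sum_apply, Matrix.smul_apply, Matrix.kroneckerMap_apply,
    Matrix.single_apply, smul_eq_mul]
  rw [Finset.sum_eq_single i, Finset.sum_eq_single j]
  · simp only [and_true, eq_comm, mul_ite, ite_and]
    split_ifs <;> simp_all
  · intro b _ hb; simp [hb]
  · simp
  · intro b _ hb; simp [hb]
  · simp

theorem bracketGroup_apply {N : ℕ} (X Y : Matrix (Fin N) (Fin N) ℂ) (i j k l : Fin N) :
    bracketGroup X Y (i, k) (j, l) =
      2 * theta i k * X k j * Y i l - X i l * Y k j * (2 * theta l j) := by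
  simp only [bracketGroup, Matrix.sub_apply, Matrix.mul_apply, Fintype.sum_prod_type,
    rMatrix_entry, Matrix.kroneckerMap_apply, ite_and]
  simp [Finset.sum_ite_eq, ite_mul, mul_ite]
  ring

theorem bracketMixed_apply {N : ℕ} (X A : Matrix (Fin N) (Fin N) ℂ) (i j k l : Fin N) :
    bracketMixed X A (i, k) (j, l) =
      -(X i k * (2 * theta k j) * A j l) - X i l * A k j * (2 * theta l j) := by
  simp only [bracketMixed, typeIIMatrix, in₁, in₂, Matrix.add_apply, Matrix.neg_apply, transpose₂, Matrix.of_apply, Matrix.mul_apply, Fintype.sum_prod_type,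
    rMatrix_entry, Matrix.kroneckerMap_apply, ite_and, Matrix.one_apply]
  simp [Finset.sum_ite_eq, ite_mul, mul_ite]
  ring

theorem bracketForm_apply {N : ℕ} (A : Matrix (Fin N) (Fin N) ℂ) (i j k l : Fin N) :
    bracketForm A (i, k) (j, l) =
      2 * theta i k * A k j * A i l - A i l * A k j * (2 * theta l j)
      + A i k * (2 * theta j k) * A j l - A k i * (2 * theta l i) * A l j := by
  have h := bracketGroup_apply A A i j k l
  simp only [bracketGroup, Matrix.sub_apply] at h
  simp only [bracketForm, Matrix.add_apply, Matrix.sub_apply, h]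
  simp only [in₁, in₂, transpose₁, Matrix.of_apply, Matrix.mul_apply, Fintype.sum_prod_type,
    rMatrix_entry, Matrix.kroneckerMap_apply, ite_and, Matrix.one_apply]
  simp [Finset.sum_ite_eq, ite_mul, mul_ite]

/-! ### Hamiltonian vector fields of the coordinate functions -/

/-- The vector of brackets of all coordinate functions with the coordinate `v`. -/
noncomputable def hamiltonianVector {N : ℕ} (x : Point N) (v : Entry N) : Point N := fun u => coordBracket x u v

/-- The second function enters only through its gradient, so the Casimir property reduces to
constancy along the finitely many fields `hamiltonianVector x v`. -/
theorem poissonBracket_eq_sum {N : ℕ} (f g : Point N → ℂ) (x : Point N) :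
    poissonBracket f g x =
      ∑ v, fderiv ℂ g x (Pi.single v 1) * fderiv ℂ f x (hamiltonianVector x v) := by
  rw [poissonBracket, Finset.sum_comm]
  refine Finset.sum_congr rfl fun v _ => ?_
  have h : hamiltonianVector x v = ∑ u, coordBracket x u v • (Pi.single u 1 : Point N) := by
    funext w
    simp [hamiltonianVector, Finset.sum_apply, Pi.single_apply]
  rw [h, map_sum, Finset.mul_sum]
  refine Finset.sum_congr rfl fun u _ => ?_
  rw [map_smul, smul_eq_mul]
  ring

/-- This is the relation `r₁₂ + r₂₁ = 2 ∑ E_{ij} ⊗ E_{ji}` in coordinates. It later trades a lower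
triangular generator for an upper triangular one, up to a full row. -/
theorem two_theta_add {N : ℕ} (i j : Fin N) : 2 * theta i j + 2 * theta j i = 2 := by
  unfold theta
  rcases lt_trichotomy i j with h | h | h
  · simp [h, h.ne, h.not_gt]
  · simp [h]; norm_num
  · simp [h, h.ne, h.not_gt]

theorem theta_self {N : ℕ} (i : Fin N) : theta i i = 1 / 2 := by simp [theta]

theorem theta_of_lt {N : ℕ} {i j : Fin N} (h : i < j) : theta i j = 0 := by
  simp [theta, h.not_gt, h.ne]

/-- The matrix whose only nonzero row is the row `k`, which is `f`. -/
def rowMatrix {N : ℕ} (k : Fin N) (f : Fin N → ℂ) : Matrix (Fin N) (Fin N) ℂ :=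
  Matrix.of fun i j => if i = k then f j else 0

section RowMatrix

variable {N : ℕ} (k : Fin N) (f : Fin N → ℂ) (X : Matrix (Fin N) (Fin N) ℂ)

theorem rowMatrix_apply (i j : Fin N) : rowMatrix k f i j = if i = k then f j else 0 := rfl

theorem mul_rowMatrix_apply (i j : Fin N) : (X * rowMatrix k f) i j = X i k * f j := by
  simp [Matrix.mul_apply, rowMatrix_apply]

theorem rowMatrix_transpose_mul_apply (i j : Fin N) :
    ((rowMatrix k f)ᵀ * X) i j = f i * X k j := by
  simp [Matrix.mul_apply, rowMatrix_apply]

theorem trace_rowMatrix : (rowMatrix k f).trace = f k := by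
  simp [Matrix.trace, rowMatrix_apply]

end RowMatrix

section Fields

variable {N : ℕ} (x : Point N) (k l : Fin N)

theorem matA_hamiltonianVector_zero :
    matA (hamiltonianVector x (0, k, l)) =
      (rowMatrix k (fun j => 2 * theta j k * matA x j l)
        - rowMatrix l (fun j => 2 * theta l j * matA x k j))ᵀ * matA x
      + matA x * (rowMatrix k (fun j => 2 * theta j k * matA x j l)
        - rowMatrix l (fun j => 2 * theta l j * matA x k j)) := by
  ext i j
  change bracketForm (matA x) (i, k) (j, l) = _
  simp only [bracketForm_apply, Matrix.transpose_sub, sub_mul, mul_sub, Matrix.add_apply,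
    Matrix.sub_apply, mul_rowMatrix_apply, rowMatrix_transpose_mul_apply]
  ring

/-- The right generator involves `𝔸` only, so the same one moves `B` and `C`. -/
theorem hamiltonianVector_zero_mixed (X : Matrix (Fin N) (Fin N) ℂ) (i j : Fin N) :
    bracketMixed X (matA x) (i, k) (j, l) =
      ((0 : Matrix (Fin N) (Fin N) ℂ) * X + X * (-rowMatrix k (fun j => 2 * theta k j * matA x j l)
        - rowMatrix l (fun j => 2 * theta l j * matA x k j))) i j := by
  simp only [bracketMixed_apply, mul_sub, zero_mul, zero_add, mul_neg, Matrix.neg_apply,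
    Matrix.sub_apply, mul_rowMatrix_apply]
  ring

theorem matB_hamiltonianVector_zero :
    matB (hamiltonianVector x (0, k, l)) =
      0 * matB x + matB x * (-rowMatrix k (fun j => 2 * theta k j * matA x j l)
        - rowMatrix l (fun j => 2 * theta l j * matA x k j)) := by
  ext i j
  exact hamiltonianVector_zero_mixed x k l (matB x) i j

theorem matC_hamiltonianVector_zero :
    matC (hamiltonianVector x (0, k, l)) =
      0 * matC x + matC x * (-rowMatrix k (fun j => 2 * theta k j * matA x j l)
        - rowMatrix l (fun j => 2 * theta l j * matA x k j)) := by
  ext i j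
  exact hamiltonianVector_zero_mixed x k l (matC x) i j

theorem neg_swapFactors_bracketMixed (X A : Matrix (Fin N) (Fin N) ℂ) (i j : Fin N) :
    (-swapFactors (bracketMixed X A)) (i, k) (j, l) =
      ((rowMatrix l fun j => 2 * theta j l * X k j)ᵀ * A
        + A * rowMatrix l fun j => 2 * theta j l * X k j) i j := by
  simp only [Matrix.neg_apply, swapFactors, Matrix.of_apply, bracketMixed_apply, Matrix.add_apply,
    mul_rowMatrix_apply, rowMatrix_transpose_mul_apply]
  ring

theorem matA_hamiltonianVector_one :
    matA (hamiltonianVector x (1, k, l)) =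
      (rowMatrix l fun j => 2 * theta j l * matB x k j)ᵀ * matA x
        + matA x * rowMatrix l fun j => 2 * theta j l * matB x k j := by
  ext i j
  exact neg_swapFactors_bracketMixed k l (matB x) (matA x) i j

theorem matA_hamiltonianVector_two :
    matA (hamiltonianVector x (2, k, l)) =
      (rowMatrix l fun j => 2 * theta j l * matC x k j)ᵀ * matA x
        + matA x * rowMatrix l fun j => 2 * theta j l * matC x k j := by
  ext i j
  exact neg_swapFactors_bracketMixed k l (matC x) (matA x) i j

/-- Both generators depend on `Y` alone, so an entry of `B` moves `B` and `C` by the same pair. -/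
theorem bracketGroup_eq (X Y : Matrix (Fin N) (Fin N) ℂ) (i j : Fin N) :
    bracketGroup X Y (i, k) (j, l) =
      ((rowMatrix k fun i => 2 * theta i k * Y i l)ᵀ * X
        + X * -rowMatrix l fun j => 2 * theta l j * Y k j) i j := by
  simp only [bracketGroup_apply, Matrix.add_apply, mul_neg, Matrix.neg_apply,
    mul_rowMatrix_apply, rowMatrix_transpose_mul_apply]
  ring

theorem matB_hamiltonianVector_one :
    matB (hamiltonianVector x (1, k, l)) =
      (rowMatrix k fun i => 2 * theta i k * matB x i l)ᵀ * matB x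
        + matB x * -rowMatrix l fun j => 2 * theta l j * matB x k j := by
  ext i j
  exact bracketGroup_eq k l (matB x) (matB x) i j

theorem matC_hamiltonianVector_one :
    matC (hamiltonianVector x (1, k, l)) =
      (rowMatrix k fun i => 2 * theta i k * matB x i l)ᵀ * matC x
        + matC x * -rowMatrix l fun j => 2 * theta l j * matB x k j := by
  ext i j
  exact bracketGroup_eq k l (matC x) (matB x) i j

theorem matC_hamiltonianVector_two :
    matC (hamiltonianVector x (2, k, l)) =
      (rowMatrix k fun i => 2 * theta i k * matC x i l)ᵀ * matC x
        + matC x * -rowMatrix l fun j => 2 * theta l j * matC x k j := by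
  ext i j
  exact bracketGroup_eq k l (matC x) (matC x) i j

/-- This bracket comes from antisymmetry, so `θ` has its arguments reversed and the signs change:
the generators are not those by which the same entry moves `C`. -/
theorem matB_hamiltonianVector_two :
    matB (hamiltonianVector x (2, k, l)) =
      (-rowMatrix k fun i => 2 * theta k i * matC x i l)ᵀ * matB x
        + matB x * rowMatrix l fun j => 2 * theta j l * matC x k j := by
  ext i j
  change (-swapFactors (bracketGroup (matC x) (matB x))) (i, k) (j, l) = _
  simp only [Matrix.neg_apply, swapFactors, Matrix.of_apply, bracketGroup_apply, Matrix.add_apply,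
    Matrix.transpose_neg, neg_mul, mul_rowMatrix_apply, rowMatrix_transpose_mul_apply]
  ring

end Fields

/-! ### Derivatives of the matrices of a triple -/

section Derivatives

variable {N : ℕ} (x h : Point N) (i j : Fin N)

theorem hasFDerivAt_coord (u : Entry N) :
    HasFDerivAt (fun y : Point N => y u) (ContinuousLinearMap.proj (R := ℂ) u) x :=
  (ContinuousLinearMap.proj (R := ℂ) (φ := fun _ : Entry N => ℂ) u).hasFDerivAt

theorem hasFDerivAt_matA :
    HasFDerivAt (fun y : Point N => matA y i j) (ContinuousLinearMap.proj (R := ℂ) (0, i, j)) x :=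
  hasFDerivAt_coord x _

theorem hasFDerivAt_matB :
    HasFDerivAt (fun y : Point N => matB y i j) (ContinuousLinearMap.proj (R := ℂ) (1, i, j)) x :=
  hasFDerivAt_coord x _

theorem hasFDerivAt_matC :
    HasFDerivAt (fun y : Point N => matC y i j) (ContinuousLinearMap.proj (R := ℂ) (2, i, j)) x :=
  hasFDerivAt_coord x _

theorem differentiable_det_matB : Differentiable ℂ fun y : Point N => (matB y).det :=
  fun y => DifferentiableAt.matrix_det fun i j => (hasFDerivAt_matB y i j).differentiableAt

theorem differentiableAt_inv_matB {x : Point N} (hB : (matB x).det ≠ 0) :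
    DifferentiableAt ℂ (fun y : Point N => (matB y)⁻¹ i j) x := by
  simp only [Matrix.inv_def, Ring.inverse_eq_inv', Matrix.smul_apply, smul_eq_mul,
    Matrix.adjugate_apply]
  refine (((differentiable_det_matB x).inv hB)).mul (DifferentiableAt.matrix_det fun a b => ?_)
  simp only [Matrix.updateRow_apply]
  split_ifs
  · exact differentiableAt_const _
  · exact (hasFDerivAt_matB x a b).differentiableAt

theorem differentiableAt_matS {x : Point N} (hB : (matB x).det ≠ 0) :
    DifferentiableAt ℂ (fun y : Point N => matS y i j) x := by
  simp only [matS, Matrix.mul_apply]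
  refine DifferentiableAt.fun_sum fun a _ => ?_
  exact (hasFDerivAt_matA x a i).differentiableAt.mul (differentiableAt_inv_matB a j hB)

theorem matS_mul_matB {x : Point N} (hB : (matB x).det ≠ 0) : matS x * matB x = (matA x)ᵀ := by
  rw [matS, Matrix.mul_assoc, Matrix.nonsing_inv_mul _ (isUnit_iff_ne_zero.2 hB), Matrix.mul_one]

/-- Differentiating `S B = 𝔸ᵀ` avoids differentiating `B⁻¹`: the hypothesis says exactly that `U S +
S P` solves the resulting linear equation, and `B` can be cancelled. -/
theorem fderiv_matS {x : Point N} (hB : (matB x).det ≠ 0) (U P : Matrix (Fin N) (Fin N) ℂ)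
    (hUP : (matA h)ᵀ = U * (matA x)ᵀ + matS x * (P * matB x + matB h)) :
    fderiv ℂ (fun y : Point N => matS y i j) x h = (U * matS x + matS x * P) i j := by
  set D : Matrix (Fin N) (Fin N) ℂ :=
    Matrix.of fun i j => fderiv ℂ (fun y : Point N => matS y i j) x h with hD
  have key : D * matB x + matS x * matB h = (matA h)ᵀ := by
    ext i j
    have h1 : HasFDerivAt (fun y : Point N => (matS y * matB y) i j)
        (∑ a, (matS x i a • (ContinuousLinearMap.proj (R := ℂ) (1, a, j))
          + matB x a j • fderiv ℂ (fun y : Point N => matS y i a) x)) x := by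
      simp only [Matrix.mul_apply]
      exact HasFDerivAt.fun_sum fun a _ =>
        (differentiableAt_matS i a hB).hasFDerivAt.mul (hasFDerivAt_matB x a j)
    -- The identity `S B = 𝔸ᵀ` is available only where `B` is invertible, which is a neighbourhood
    -- of `x`.
    have h2 : (fun y : Point N => matA y j i) =ᶠ[nhds x] fun y => (matS y * matB y) i j := by
      filter_upwards [(differentiable_det_matB x).continuousAt.eventually_ne hB] with y hy
      rw [matS_mul_matB hy, Matrix.transpose_apply]
    have h3 := DFunLike.congr_fun ((h1.congr_of_eventuallyEq h2).unique (hasFDerivAt_matA x j i)) h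
    rw [Matrix.transpose_apply]
    refine Eq.trans ?_ h3
    simp only [sum_apply, Matrix.add_apply, Matrix.mul_apply,
      ← Finset.sum_add_distrib]
    refine Finset.sum_congr rfl fun a _ => ?_
    simp [hD, matB]
    ring
  have h4 : D * matB x = (U * matS x + matS x * P) * matB x := by
    rw [eq_sub_of_add_eq key, hUP, ← matS_mul_matB hB]
    noncomm_ring
  have hu := isUnit_iff_ne_zero.2 hB
  have h5 := congrArg (· * (matB x)⁻¹) h4
  simp only [Matrix.mul_nonsing_inv_cancel_right _ _ hu] at h5
  exact congrFun (congrFun h5 i) j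

end Derivatives

/-! ### Logarithmic derivatives of determinants and minors along Hamiltonian fields -/

section Minors

variable {N : ℕ} {x h : Point N}

/-- Transposing the congruence equation for `𝔸` gives the same equation for `𝔸ᵀ`, hence for every
combination. The point is that the factor is free of `s` and `t`. -/
theorem hasLogDerivAt_det_form {α : Matrix (Fin N) (Fin N) ℂ}
    (hA : matA h = αᵀ * matA x + matA x * α) (s t : ℂ) :
    HasLogDerivAt (fun y : Point N => (s • matA y + t • (matA y)ᵀ).det) x h
      (αᵀ.trace + α.trace) := by
  have hd : ∀ i j, HasFDerivAt (fun y : Point N => (s • matA y + t • (matA y)ᵀ) i j)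
      (s • (ContinuousLinearMap.proj (R := ℂ) (0, i, j))
        + t • (ContinuousLinearMap.proj (R := ℂ) (0, j, i))) x := fun i j =>
    ((hasFDerivAt_matA x i j).const_smul s).add ((hasFDerivAt_matA x j i).const_smul t)
  refine hasLogDerivAt_det (fun i j => (hd i j).differentiableAt) fun i j => ?_
  rw [(hd i j).fderiv]
  have h1 : αᵀ * (s • matA x + t • (matA x)ᵀ) + (s • matA x + t • (matA x)ᵀ) * α
      = s • matA h + t • (matA h)ᵀ := by
    rw [hA, Matrix.transpose_add, Matrix.transpose_mul, Matrix.transpose_mul,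
      Matrix.transpose_transpose]
    simp only [mul_add, add_mul, smul_add, Matrix.mul_smul, Matrix.smul_mul]
    abel
  rw [h1]
  rfl

theorem hasLogDerivAt_det_pencil {L R : Matrix (Fin N) (Fin N) ℂ} (t : ℂ)
    (hK : matB h + t • matC h = L * (matB x + t • matC x) + (matB x + t • matC x) * R) :
    HasLogDerivAt (fun y : Point N => (matB y + t • matC y).det) x h (L.trace + R.trace) := by
  have hd : ∀ i j, HasFDerivAt (fun y : Point N => (matB y + t • matC y) i j)
      ((ContinuousLinearMap.proj (R := ℂ) (1, i, j))
        + t • (ContinuousLinearMap.proj (R := ℂ) (2, i, j))) x := fun i j =>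
    (hasFDerivAt_matB x i j).add ((hasFDerivAt_matC x i j).const_smul t)
  refine hasLogDerivAt_det (fun i j => (hd i j).differentiableAt) fun i j => ?_
  rw [(hd i j).fderiv, ← hK]
  rfl

theorem hasLogDerivAt_det_matC {L R : Matrix (Fin N) (Fin N) ℂ}
    (hC : matC h = L * matC x + matC x * R) :
    HasLogDerivAt (fun y : Point N => (matC y).det) x h (L.trace + R.trace) := by
  refine hasLogDerivAt_det (fun i j => (hasFDerivAt_matC x i j).differentiableAt) fun i j => ?_
  rw [(hasFDerivAt_matC x i j).fderiv, ← hC]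
  rfl

theorem mem_range_castLE {q : ℕ} (hq : q ≤ N) (k : Fin N) :
    k ∈ Set.range (Fin.castLE hq) ↔ (k : ℕ) < q :=
  ⟨fun ⟨i, hi⟩ => hi ▸ i.2, fun hk => ⟨⟨k, hk⟩, rfl⟩⟩

/-- The inclusion of the last `q` indices. -/
def lastIndex {q : ℕ} (hq : q ≤ N) (j : Fin q) : Fin N := ⟨N - q + j, by omega⟩

theorem lastIndex_injective {q : ℕ} (hq : q ≤ N) : Function.Injective (lastIndex hq) := by
  intro i j hij
  have := congrArg Fin.val hij
  simp only [lastIndex] at this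
  exact Fin.ext (by omega)

theorem mem_range_lastIndex {q : ℕ} (hq : q ≤ N) (k : Fin N) :
    k ∈ Set.range (lastIndex hq) ↔ N - q ≤ (k : ℕ) := by
  refine ⟨fun ⟨i, hi⟩ => hi ▸ by simp [lastIndex], fun hk => ⟨⟨k - (N - q), by omega⟩, ?_⟩⟩
  exact Fin.ext (by simp only [lastIndex]; omega)

/-- A lower triangular left action mixes the first `q` rows only among themselves, and an upper
triangular right action does the same for the first `q` columns. -/
theorem hasLogDerivAt_upperLeftMinor_matS (hB : (matB x).det ≠ 0)
    {U P : Matrix (Fin N) (Fin N) ℂ}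
    (hUP : (matA h)ᵀ = U * (matA x)ᵀ + matS x * (P * matB x + matB h))
    (hU : ∀ i j, i < j → U i j = 0) (hP : ∀ i j, j < i → P i j = 0) (q : ℕ) (hq : q ≤ N) :
    HasLogDerivAt (fun y : Point N => upperLeftMinor (matS y) q hq) x h
      (∑ i : Fin q, U (Fin.castLE hq i) (Fin.castLE hq i)
        + ∑ i : Fin q, P (Fin.castLE hq i) (Fin.castLE hq i)) := by
  refine hasLogDerivAt_det_submatrix _ _ (Fin.castLE_injective hq) (Fin.castLE_injective hq)
    (fun i j => differentiableAt_matS i j hB) (fun i j => fderiv_matS h i j hB U P hUP)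
    (fun i k hk => hU _ _ ?_) (fun k j hk => hP _ _ ?_)
  all_goals
    rw [mem_range_castLE] at hk
    rw [Fin.lt_def, Fin.val_castLE]
    omega

/-- Here the right action must be lower triangular, because it is the last `q` columns that have to
be preserved. -/
theorem hasLogDerivAt_upperRightMinor_matC {L R : Matrix (Fin N) (Fin N) ℂ}
    (hC : matC h = L * matC x + matC x * R)
    (hL : ∀ i j, i < j → L i j = 0) (hR : ∀ i j, i < j → R i j = 0) (q : ℕ) (hq : q ≤ N) :
    HasLogDerivAt (fun y : Point N => upperRightMinor (matC y) q hq) x h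
      (∑ i : Fin q, L (Fin.castLE hq i) (Fin.castLE hq i)
        + ∑ i : Fin q, R (lastIndex hq i) (lastIndex hq i)) := by
  refine hasLogDerivAt_det_submatrix _ _ (Fin.castLE_injective hq) (lastIndex_injective hq)
    (fun i j => (hasFDerivAt_matC x i j).differentiableAt)
    (fun i j => ?_) (fun i k hk => hL _ _ ?_) (fun k j hk => hR _ _ ?_)
  · rw [(hasFDerivAt_matC x i j).fderiv, ← hC]
    rfl
  · rw [mem_range_castLE] at hk
    rw [Fin.lt_def, Fin.val_castLE]
    omega
  · have hk' := (mem_range_lastIndex hq k).not.1 hk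
    change (k : ℕ) < N - q + j
    omega

theorem sum_rowMatrix_diag {m : Type*} [Fintype m] (r : m → Fin N)
    (hr : Function.Injective r) (k : Fin N) (f : Fin N → ℂ) (p : Prop) [Decidable p]
    (hp : k ∈ Set.range r ↔ p) :
    ∑ i, rowMatrix k f (r i) (r i) = if p then f k else 0 := by
  classical
  simp only [rowMatrix_apply]
  split_ifs with h
  · obtain ⟨i, rfl⟩ := hp.2 h
    rw [Finset.sum_eq_single i]
    · simp
    · intro b _ hb
      rw [if_neg (hr.ne hb)]
    · simp
  · refine Finset.sum_eq_zero fun i _ => if_neg ?_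
    rintro rfl
    exact h (hp.1 ⟨i, rfl⟩)

theorem sum_rowMatrix_castLE {q : ℕ} (hq : q ≤ N) (k : Fin N) (f : Fin N → ℂ) :
    ∑ i : Fin q, rowMatrix k f (Fin.castLE hq i) (Fin.castLE hq i)
      = if (k : ℕ) < q then f k else 0 :=
  sum_rowMatrix_diag _ (Fin.castLE_injective hq) k f _ (mem_range_castLE hq k)

theorem sum_rowMatrix_lastIndex {q : ℕ} (hq : q ≤ N) (k : Fin N) (f : Fin N → ℂ) :
    ∑ i : Fin q, rowMatrix k f (lastIndex hq i) (lastIndex hq i)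
      = if N - q ≤ (k : ℕ) then f k else 0 :=
  sum_rowMatrix_diag _ (lastIndex_injective hq) k f _ (mem_range_lastIndex hq k)

theorem rowMatrix_theta_lower (k : Fin N) (f : Fin N → ℂ) (i j : Fin N) (hij : i < j) :
    rowMatrix k (fun j => 2 * theta k j * f j) i j = 0 := by
  rw [rowMatrix_apply]
  split_ifs with h
  · subst h; simp [theta_of_lt hij]
  · rfl

theorem rowMatrix_theta_upper (k : Fin N) (f : Fin N → ℂ) (i j : Fin N) (hij : j < i) :
    rowMatrix k (fun j => 2 * theta j k * f j) i j = 0 := by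
  rw [rowMatrix_apply]
  split_ifs with h
  · subst h; simp [theta_of_lt hij]
  · rfl

theorem rowMatrix_theta_add (k : Fin N) (f : Fin N → ℂ) :
    rowMatrix k (fun j => 2 * theta j k * f j) + rowMatrix k (fun j => 2 * theta k j * f j)
      = rowMatrix k fun j => 2 * f j := by
  ext i j
  simp only [Matrix.add_apply, rowMatrix_apply]
  split_ifs
  · rw [← add_mul, two_theta_add]
  · simp

end Minors

/-! ### Parameter-independent logarithmic derivatives of the two pencils -/

section Hamiltonian

variable {N : ℕ} (x : Point N)

theorem exists_hasLogDerivAt_det_form (v : Entry N) :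
    ∃ c : ℂ, ∀ s t : ℂ, HasLogDerivAt
      (fun y : Point N => (s • matA y + t • (matA y)ᵀ).det) x (hamiltonianVector x v) c := by
  obtain ⟨a, k, l⟩ := v
  fin_cases a
  · exact ⟨_, hasLogDerivAt_det_form (matA_hamiltonianVector_zero x k l)⟩
  · exact ⟨_, hasLogDerivAt_det_form (matA_hamiltonianVector_one x k l)⟩
  · exact ⟨_, hasLogDerivAt_det_form (matA_hamiltonianVector_two x k l)⟩

/-- The generators moving `C` differ from those moving `B` by full rows without `θ`, and on `C`
itself the left and right full-row terms both equal `2 c_{il} c_{kj}` and cancel. So the generators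
for `B` serve for `C` as well. -/
theorem hamiltonianVector_two_pencil (k l : Fin N) (t : ℂ) :
    matB (hamiltonianVector x (2, k, l)) + t • matC (hamiltonianVector x (2, k, l)) =
      (-rowMatrix k fun i => 2 * theta k i * matC x i l)ᵀ * (matB x + t • matC x)
      + (matB x + t • matC x) * (rowMatrix l fun j => 2 * theta j l * matC x k j) := by
  have h1 : (rowMatrix k fun i => 2 * theta i k * matC x i l)ᵀ
      = (rowMatrix k fun i => 2 * matC x i l)ᵀ
        - (rowMatrix k fun i => 2 * theta k i * matC x i l)ᵀ := by
    rw [← rowMatrix_theta_add k fun i => matC x i l, Matrix.transpose_add, add_sub_cancel_right]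
  have h2 : (rowMatrix l fun j => 2 * theta l j * matC x k j)
      = (rowMatrix l fun j => 2 * matC x k j) - (rowMatrix l fun j => 2 * theta j l * matC x k j) := by
    rw [← rowMatrix_theta_add l fun j => matC x k j, add_sub_cancel_left]
  have h3 : (rowMatrix k fun i => 2 * matC x i l)ᵀ * matC x
      = matC x * rowMatrix l fun j => 2 * matC x k j := by
    ext i j
    rw [mul_rowMatrix_apply, rowMatrix_transpose_mul_apply]
    ring
  rw [matB_hamiltonianVector_two, matC_hamiltonianVector_two, h1, h2]
  simp only [sub_mul, h3, mul_neg, mul_sub, smul_add, smul_sub, smul_neg,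
    mul_add, add_mul, Matrix.mul_smul, Matrix.smul_mul, Matrix.transpose_neg, neg_mul]
  abel

theorem exists_hasLogDerivAt_det_pencil (v : Entry N) :
    ∃ c : ℂ, ∀ t : ℂ, HasLogDerivAt
      (fun y : Point N => (matB y + t • matC y).det) x (hamiltonianVector x v) c := by
  obtain ⟨a, k, l⟩ := v
  fin_cases a
  · refine ⟨_, fun t => hasLogDerivAt_det_pencil t (L := 0)
      (R := -rowMatrix k (fun j => 2 * theta k j * matA x j l)
        - rowMatrix l (fun j => 2 * theta l j * matA x k j)) ?_⟩
    change matB (hamiltonianVector x (0, k, l)) + t • matC (hamiltonianVector x (0, k, l)) = _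
    rw [matB_hamiltonianVector_zero, matC_hamiltonianVector_zero]
    simp only [zero_mul, zero_add, add_mul, Matrix.smul_mul]
  · refine ⟨_, fun t => hasLogDerivAt_det_pencil t
      (L := (rowMatrix k fun i => 2 * theta i k * matB x i l)ᵀ)
      (R := -rowMatrix l fun j => 2 * theta l j * matB x k j) ?_⟩
    change matB (hamiltonianVector x (1, k, l)) + t • matC (hamiltonianVector x (1, k, l)) = _
    rw [matB_hamiltonianVector_one, matC_hamiltonianVector_one]
    simp only [mul_add, smul_add, add_mul, Matrix.smul_mul, Matrix.mul_smul]
    abel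
  · refine ⟨_, fun t => hasLogDerivAt_det_pencil t
      (L := (-rowMatrix k fun i => 2 * theta k i * matC x i l)ᵀ)
      (R := rowMatrix l fun j => 2 * theta j l * matC x k j) ?_⟩
    exact (hamiltonianVector_two_pencil x k l t)

end Hamiltonian

/-! ### The functions `X_p` commute with all coordinates -/

section CasimirX

variable {N : ℕ} {x h : Point N} {p : ℕ} {hp : p ≤ N}

/-- This isolates the bookkeeping common to the three kinds of coordinates: `s q` and `c q` are the
weights of the minors of `S` and `C`, the numbers `dA`, `dB`, `dC` those of the determinants, and
`h0` says that the total weight of `X_p` is zero. -/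
theorem hasLogDerivAt_casimirX_of_fields (hx : x ∈ domainX N p hp)
    {α U P LB RB L R : Matrix (Fin N) (Fin N) ℂ}
    (hA : matA h = αᵀ * matA x + matA x * α)
    (hUP : (matA h)ᵀ = U * (matA x)ᵀ + matS x * (P * matB x + matB h))
    (hU : ∀ i j, i < j → U i j = 0) (hP : ∀ i j, j < i → P i j = 0)
    (hB : matB h = LB * matB x + matB x * RB)
    (hC : matC h = L * matC x + matC x * R)
    (hL : ∀ i j, i < j → L i j = 0) (hR : ∀ i j, i < j → R i j = 0)
    {s c : ℕ → ℂ} {dA dB dC : ℂ}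
    (hs : ∀ (q : ℕ) (hq : q ≤ N), ∑ i : Fin q, U (Fin.castLE hq i) (Fin.castLE hq i)
        + ∑ i : Fin q, P (Fin.castLE hq i) (Fin.castLE hq i) = s q)
    (hc : ∀ (q : ℕ) (hq : q ≤ N), ∑ i : Fin q, L (Fin.castLE hq i) (Fin.castLE hq i)
        + ∑ i : Fin q, R (lastIndex hq i) (lastIndex hq i) = c q)
    (htA : αᵀ.trace + α.trace = dA) (htB : LB.trace + RB.trace = dB)
    (htC : L.trace + R.trace = dC)
    (h0 : s p + s (N - p) - (c (N - p) + c p) + (dB + dC - dA) = 0) :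
    HasLogDerivAt (casimirX p hp) x h 0 := by
  obtain ⟨⟨⟨hB0, hC0⟩, hA0⟩, h1, h2⟩ := hx
  have hS := fun q hq => hasLogDerivAt_upperLeftMinor_matS hB0 hUP hU hP q hq
  have hM := fun q hq => hasLogDerivAt_upperRightMinor_matC hC hL hR q hq
  -- The single determinants of `𝔸` and `B` are the pencils at the parameters `(1, 0)` and `0`.
  have hdA := hasLogDerivAt_det_form hA 1 0
  have hdB := hasLogDerivAt_det_pencil (x := x) (h := h) (L := LB) (R := RB) 0 (by simpa using hB)
  have hdC := hasLogDerivAt_det_matC hC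
  simp only [hs] at hS
  simp only [hc] at hM
  simp only [one_smul, zero_smul, add_zero, htA] at hdA
  simp only [zero_smul, add_zero, htB] at hdB
  rw [htC] at hdC
  rw [← h0]
  exact (((hS p hp).mul (hS (N - p) _)).div ((hM (N - p) _).mul (hM p hp))
    (mul_ne_zero h2 h1)).mul ((hdB.mul hdC).div hdA hA0)

/-- Any index is counted exactly once among the first `p` and the last `N - p` ones. -/
theorem indicator_add_indicator (hp : p ≤ N) (k : Fin N) (a : ℂ) :
    (if (k : ℕ) < p then a else 0) + (if N - (N - p) ≤ (k : ℕ) then a else 0) = a := by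
  split_ifs <;> first | omega | simp

theorem indicator_add_indicator' (p : ℕ) (k : Fin N) (a : ℂ) :
    (if (k : ℕ) < N - p then a else 0) + (if N - p ≤ (k : ℕ) then a else 0) = a := by
  split_ifs <;> first | omega | simp

/-- The right action on `S` can be removed altogether: subtracting the generator of `B` from that of
`𝔸` leaves a full row, and `𝔸ᵀ` times it is a left multiplication that turns the remaining generator
lower triangular. Hence `P = 0`. -/
theorem hasLogDerivAt_casimirX_zero (hx : x ∈ domainX N p hp) (k l : Fin N) :
    HasLogDerivAt (casimirX p hp) x (hamiltonianVector x (0, k, l)) 0 := by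
  have hB0 := hx.1.1.1
  refine hasLogDerivAt_casimirX_of_fields hx
    (U := (rowMatrix k (fun i => 2 * theta i k * matA x i l))ᵀ
      + (rowMatrix l (fun i => 2 * theta i l * matA x k i))ᵀ) (P := 0)
    (matA_hamiltonianVector_zero x k l) ?_ ?_ ?_ (matB_hamiltonianVector_zero x k l)
    (matC_hamiltonianVector_zero x k l) ?_ ?_
    (s := fun q => (if (k : ℕ) < q then matA x k l else 0) + if (l : ℕ) < q then matA x k l else 0)
    (c := fun q => -((if N - q ≤ (k : ℕ) then matA x k l else 0)
      + if N - q ≤ (l : ℕ) then matA x k l else 0))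
    (dA := 0) (dB := -2 * matA x k l) (dC := -2 * matA x k l) ?_ ?_ ?_ ?_ ?_ ?_
  · have h1 : (rowMatrix l fun i => 2 * theta i l * matA x k i)
        = (rowMatrix l fun i => 2 * matA x k i) - rowMatrix l fun i => 2 * theta l i * matA x k i := by
      rw [← rowMatrix_theta_add l fun i => matA x k i, add_sub_cancel_right]
    have h2 : (rowMatrix k fun i => 2 * theta k i * matA x i l)
        = (rowMatrix k fun i => 2 * matA x i l) - rowMatrix k fun i => 2 * theta i k * matA x i l := by
      rw [← rowMatrix_theta_add k fun i => matA x i l, add_sub_cancel_left]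
    have h3 : (matA x)ᵀ * (rowMatrix k fun i => 2 * matA x i l)
        = (rowMatrix l fun i => 2 * matA x k i)ᵀ * (matA x)ᵀ := by
      ext i j
      rw [mul_rowMatrix_apply, rowMatrix_transpose_mul_apply]
      simp only [Matrix.transpose_apply]
      ring
    rw [matA_hamiltonianVector_zero, matB_hamiltonianVector_zero, h1, h2]
    simp only [zero_mul, zero_add, ← Matrix.mul_assoc, matS_mul_matB hB0, Matrix.transpose_add,
      Matrix.transpose_mul, Matrix.transpose_sub, Matrix.transpose_transpose, mul_sub, sub_mul,
      add_mul, h3, neg_sub]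
    abel
  · intro i j hij
    simp only [Matrix.add_apply, Matrix.transpose_apply]
    rw [rowMatrix_theta_upper _ _ _ _ hij, rowMatrix_theta_upper _ _ _ _ hij, add_zero]
  · intro i j _; rfl
  · intro i j _; rfl
  · intro i j hij
    simp only [Matrix.sub_apply, Matrix.neg_apply]
    rw [rowMatrix_theta_lower _ _ _ _ hij, rowMatrix_theta_lower _ _ _ _ hij, neg_zero, sub_zero]
  · intro q hq
    simp only [Matrix.add_apply, Matrix.transpose_apply, Finset.sum_add_distrib,
      sum_rowMatrix_castLE, theta_self, Matrix.zero_apply, Finset.sum_const_zero, add_zero]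
    norm_num
  · intro q hq
    simp only [Matrix.sub_apply, Matrix.neg_apply, Finset.sum_sub_distrib, Finset.sum_neg_distrib,
      sum_rowMatrix_lastIndex, theta_self, Matrix.zero_apply, Finset.sum_const_zero, zero_add]
    norm_num
    ring
  · simp [trace_rowMatrix, theta_self]
  · simp [trace_rowMatrix, theta_self]
    ring
  · simp [trace_rowMatrix, theta_self]
    ring
  -- Each of `k` and `l` is counted once by `M_S^p` together with `M_C^{N-p}` and once by
  -- `M_S^{N-p}` together with `M_C^p`. The resulting `4 a_{kl}` is offset by `det B` and `det C`.
  · linear_combination indicator_add_indicator hp k (matA x k l)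
      + indicator_add_indicator hp l (matA x k l) + indicator_add_indicator' p k (matA x k l)
      + indicator_add_indicator' p l (matA x k l)

/-- The left half of the congruence of `𝔸` is already lower triangular and becomes `U`. The right
half combines with the right generator of `B` into a full row, which moves to the left of `B` and
leaves the upper triangular `P`. -/
theorem hasLogDerivAt_casimirX_one (hx : x ∈ domainX N p hp) (k l : Fin N) :
    HasLogDerivAt (casimirX p hp) x (hamiltonianVector x (1, k, l)) 0 := by
  have hB0 := hx.1.1.1
  refine hasLogDerivAt_casimirX_of_fields hx
    (U := (rowMatrix l (fun i => 2 * theta i l * matB x k i))ᵀ)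
    (P := (rowMatrix k (fun i => 2 * theta k i * matB x i l))ᵀ)
    (matA_hamiltonianVector_one x k l) ?_ ?_ ?_ (matB_hamiltonianVector_one x k l)
    (matC_hamiltonianVector_one x k l) ?_ ?_
    (s := fun q => (if (l : ℕ) < q then matB x k l else 0) + if (k : ℕ) < q then matB x k l else 0)
    (c := fun q => (if (k : ℕ) < q then matB x k l else 0)
      - if N - q ≤ (l : ℕ) then matB x k l else 0)
    (dA := 2 * matB x k l) (dB := 0) (dC := 0) ?_ ?_ ?_ ?_ ?_ ?_
  · have h1 : (rowMatrix l fun i => 2 * theta i l * matB x k i)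
        = (rowMatrix l fun i => 2 * matB x k i) - rowMatrix l fun i => 2 * theta l i * matB x k i := by
      rw [← rowMatrix_theta_add l fun i => matB x k i, add_sub_cancel_right]
    have h2 : (rowMatrix k fun i => 2 * theta k i * matB x i l)
        = (rowMatrix k fun i => 2 * matB x i l) - rowMatrix k fun i => 2 * theta i k * matB x i l := by
      rw [← rowMatrix_theta_add k fun i => matB x i l, add_sub_cancel_left]
    have h3 : (rowMatrix k fun i => 2 * matB x i l)ᵀ * matB x
        = matB x * (rowMatrix l fun i => 2 * matB x k i) := by
      ext i j
      rw [mul_rowMatrix_apply, rowMatrix_transpose_mul_apply]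
      ring
    rw [matA_hamiltonianVector_one, matB_hamiltonianVector_one, h1, h2]
    simp only [Matrix.transpose_sub, Matrix.transpose_mul, Matrix.transpose_transpose,
      Matrix.transpose_add, ← matS_mul_matB hB0, sub_mul, h3]
    noncomm_ring
  · intro i j hij
    exact rowMatrix_theta_upper _ _ _ _ hij
  · intro i j hij
    exact rowMatrix_theta_lower k (fun i => matB x i l) _ _ hij
  · intro i j hij
    exact rowMatrix_theta_upper k (fun i => matB x i l) _ _ hij
  · intro i j hij
    rw [Matrix.neg_apply, rowMatrix_theta_lower _ _ _ _ hij, neg_zero]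
  · intro q hq
    simp only [Matrix.transpose_apply, sum_rowMatrix_castLE, theta_self]
    norm_num
  · intro q hq
    simp only [Matrix.transpose_apply, Matrix.neg_apply, Finset.sum_neg_distrib,
      sum_rowMatrix_castLE, sum_rowMatrix_lastIndex, theta_self]
    norm_num
    ring
  · simp [trace_rowMatrix, theta_self]
    ring
  · simp [trace_rowMatrix, theta_self]
  · simp [trace_rowMatrix, theta_self]
  · linear_combination indicator_add_indicator hp l (matB x k l)
      + indicator_add_indicator' p l (matB x k l)

/-- No exchange of triangular parts is needed here: the right generators of `𝔸` and `B` coincide,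
and `P` is minus the left generator of `B`. -/
theorem hasLogDerivAt_casimirX_two (hx : x ∈ domainX N p hp) (k l : Fin N) :
    HasLogDerivAt (casimirX p hp) x (hamiltonianVector x (2, k, l)) 0 := by
  have hB0 := hx.1.1.1
  refine hasLogDerivAt_casimirX_of_fields hx
    (U := (rowMatrix l (fun i => 2 * theta i l * matC x k i))ᵀ)
    (P := (rowMatrix k (fun i => 2 * theta k i * matC x i l))ᵀ)
    (matA_hamiltonianVector_two x k l) ?_ ?_ ?_ (matB_hamiltonianVector_two x k l)
    (matC_hamiltonianVector_two x k l) ?_ ?_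
    (s := fun q => (if (l : ℕ) < q then matC x k l else 0) + if (k : ℕ) < q then matC x k l else 0)
    (c := fun q => (if (k : ℕ) < q then matC x k l else 0)
      - if N - q ≤ (l : ℕ) then matC x k l else 0)
    (dA := 2 * matC x k l) (dB := 0) (dC := 0) ?_ ?_ ?_ ?_ ?_ ?_
  · rw [matA_hamiltonianVector_two, matB_hamiltonianVector_two, Matrix.transpose_add]
    simp only [Matrix.transpose_mul, Matrix.transpose_transpose, ← matS_mul_matB hB0,
      Matrix.transpose_neg]
    noncomm_ring
  · intro i j hij
    exact rowMatrix_theta_upper _ _ _ _ hij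
  · intro i j hij
    exact rowMatrix_theta_lower k (fun i => matC x i l) _ _ hij
  · intro i j hij
    exact rowMatrix_theta_upper k (fun i => matC x i l) _ _ hij
  · intro i j hij
    rw [Matrix.neg_apply, rowMatrix_theta_lower _ _ _ _ hij, neg_zero]
  · intro q hq
    simp only [Matrix.transpose_apply, sum_rowMatrix_castLE, theta_self]
    norm_num
  · intro q hq
    simp only [Matrix.transpose_apply, Matrix.neg_apply, Finset.sum_neg_distrib,
      sum_rowMatrix_castLE, sum_rowMatrix_lastIndex, theta_self]
    norm_num
    ring
  · simp [trace_rowMatrix, theta_self]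
    ring
  · simp [trace_rowMatrix, theta_self]
  · simp [trace_rowMatrix, theta_self]
  · linear_combination indicator_add_indicator hp l (matC x k l)
      + indicator_add_indicator' p l (matC x k l)

end CasimirX

/-! ### Casimir functions -/

/-- Lagrange interpolation at fixed nodes. Since the weights do not depend on the polynomial,
constancy along a field passes from the determinant ratios at each parameter to their coefficients.
-/
theorem exists_coeff_eq_sum_eval (n k : ℕ) : ∃ c v : Fin (n + 1) → ℂ,
    ∀ q : Polynomial ℂ, q.natDegree ≤ n → q.coeff k = ∑ j, c j * q.eval (v j) := by
  refine ⟨fun j => (Lagrange.basis Finset.univ (fun j : Fin (n + 1) => ((j : ℕ) : ℂ)) j).coeff k,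
    fun j => ((j : ℕ) : ℂ), fun q hq => ?_⟩
  have hinj : Set.InjOn (fun j : Fin (n + 1) => ((j : ℕ) : ℂ)) (Finset.univ : Finset (Fin (n + 1))) := by
    intro a _ b _ hab
    exact Fin.ext (Nat.cast_injective hab)
  have hdeg : q.degree < (Finset.univ : Finset (Fin (n + 1))).card := by
    rw [Finset.card_univ, Fintype.card_fin]
    refine lt_of_le_of_lt Polynomial.degree_le_natDegree ?_
    exact_mod_cast Nat.lt_succ_of_le hq
  conv_lhs => rw [Lagrange.eq_interpolate hinj hdeg]
  rw [Lagrange.interpolate_apply, Polynomial.finsetSum_coeff]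
  refine Finset.sum_congr rfl fun j _ => ?_
  rw [Polynomial.coeff_C_mul, mul_comm]

theorem HasLogDerivAt.sum_const_mul {E : Type*} [NormedAddCommGroup E] [NormedSpace ℂ E]
    {ι : Type*} [Fintype ι] {f : ι → E → ℂ} {x h : E} (c : ι → ℂ)
    (hf : ∀ j, HasLogDerivAt (f j) x h 0) :
    HasLogDerivAt (fun y => ∑ j, c j * f j y) x h 0 := by
  have h1 : HasFDerivAt (fun y => ∑ j, c j * f j y) (∑ j, c j • fderiv ℂ (f j) x) x :=
    HasFDerivAt.fun_sum fun j _ => (hf j).1.hasFDerivAt.const_mul (c j)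
  refine ⟨h1.differentiableAt, ?_⟩
  rw [h1.fderiv]
  simp [sum_apply, (hf _).2]

/-- Differentiability is a separate hypothesis because for `N = 0` there is no coordinate `v` from
which to extract it. -/
theorem IsCasimirOn.of_hasLogDerivAt {N : ℕ} {U : Set (Point N)} {f : Point N → ℂ} (hU : IsOpen U)
    (hdiff : ∀ x ∈ U, DifferentiableAt ℂ f x)
    (hf : ∀ x ∈ U, ∀ v, HasLogDerivAt f x (hamiltonianVector x v) 0) : IsCasimirOn U f := by
  refine ⟨hU, fun x hx => (hdiff x hx).differentiableWithinAt, fun g _ x hx => ?_⟩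
  rw [poissonBracket_eq_sum]
  refine Finset.sum_eq_zero fun v _ => ?_
  rw [(hf x hx v).2, zero_mul, mul_zero]

/-! ### Openness of the domains -/

section Domains

variable {N : ℕ}

theorem continuous_matA : Continuous (matA : Point N → Matrix (Fin N) (Fin N) ℂ) :=
  continuous_matrix fun _ _ => continuous_apply _

theorem continuous_matB : Continuous (matB : Point N → Matrix (Fin N) (Fin N) ℂ) :=
  continuous_matrix fun _ _ => continuous_apply _

theorem continuous_matC : Continuous (matC : Point N → Matrix (Fin N) (Fin N) ℂ) :=
  continuous_matrix fun _ _ => continuous_apply _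

theorem isOpen_tripleSpace : IsOpen (tripleSpace N) :=
  (isOpen_ne_fun continuous_matB.matrix_det continuous_const).inter
    (isOpen_ne_fun continuous_matC.matrix_det continuous_const)

theorem isOpen_nondegenerateTriples : IsOpen (nondegenerateTriples N) :=
  isOpen_tripleSpace.inter (isOpen_ne_fun continuous_matA.matrix_det continuous_const)

theorem continuous_upperRightMinor (q : ℕ) (hq : q ≤ N) :
    Continuous fun x : Point N => upperRightMinor (matC x) q hq :=
  (continuous_matC.matrix_submatrix _ _).matrix_det

theorem isOpen_domainX (p : ℕ) (hp : p ≤ N) : IsOpen (domainX N p hp) :=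
  isOpen_nondegenerateTriples.inter
    ((isOpen_ne_fun (continuous_upperRightMinor p hp) continuous_const).inter
      (isOpen_ne_fun (continuous_upperRightMinor _ _) continuous_const))

end Domains

/-! ### `Y_p` and `Z_p` as normalised coefficients; the Casimir property of the three families -/

section Coefficients

variable {N : ℕ}

theorem matA_zero : matA (0 : Point N) = 0 := rfl

theorem matB_zero : matB (0 : Point N) = 0 := rfl

theorem matC_zero : matC (0 : Point N) = 0 := rfl

/-- The polynomial `det (T 𝔸 + 𝔸ᵀ)` in `T`. -/
noncomputable def formPoly (x : Point N) : Polynomial ℂ :=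
  ((Polynomial.X : Polynomial ℂ) • (matA x).map Polynomial.C
    + (matA x)ᵀ.map Polynomial.C).det

/-- The polynomial `det (B + T C)` in `T`. -/
noncomputable def pencilPoly (x : Point N) : Polynomial ℂ :=
  ((Polynomial.X : Polynomial ℂ) • (matC x).map Polynomial.C + (matB x).map Polynomial.C).det

theorem eval_det_X_smul_add (A B : Matrix (Fin N) (Fin N) ℂ) (t : ℂ) :
    ((Polynomial.X : Polynomial ℂ) • A.map Polynomial.C + B.map Polynomial.C).det.eval t
      = (t • A + B).det := by
  rw [← Polynomial.coe_evalRingHom, RingHom.map_det]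
  congr 1
  ext i j
  simp only [Polynomial.coe_evalRingHom, RingHom.mapMatrix_apply, Matrix.map_apply,
    Matrix.add_apply, Matrix.smul_apply, smul_eq_mul, Polynomial.eval_add, Polynomial.eval_mul,
    Polynomial.eval_X, Polynomial.eval_C]

theorem eval_formPoly (x : Point N) (t : ℂ) :
    (formPoly x).eval t = (t • matA x + (1 : ℂ) • (matA x)ᵀ).det := by
  rw [formPoly, eval_det_X_smul_add, one_smul]

theorem eval_pencilPoly (x : Point N) (t : ℂ) :
    (pencilPoly x).eval t = (matB x + t • matC x).det := by
  rw [pencilPoly, eval_det_X_smul_add, add_comm]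

theorem natDegree_formPoly_le (x : Point N) : (formPoly x).natDegree ≤ N :=
  (Polynomial.natDegree_det_X_add_C_le _ _).trans (Fintype.card_fin N).le

theorem natDegree_pencilPoly_le (x : Point N) : (pencilPoly x).natDegree ≤ N :=
  (Polynomial.natDegree_det_X_add_C_le _ _).trans (Fintype.card_fin N).le

/-- The functions `Y_p`; the middle coefficient is halved, its monomial occurs twice. -/
noncomputable def casimirY (p : Fin (N / 2)) (x : Point N) : ℂ :=
  (if 2 * ((p : ℕ) + 1) = N then 1 / 2 else 1) * ((formPoly x).coeff (p + 1) / (matA x).det)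

/-- The functions `Z_p`. -/
noncomputable def casimirZ (p : Fin N) (x : Point N) : ℂ :=
  (pencilPoly x).coeff (p + 1) / (matB x).det

theorem isCasimirOn_casimirY (p : Fin (N / 2)) :
    IsCasimirOn (nondegenerateTriples N) (casimirY p) := by
  have key : ∀ x ∈ nondegenerateTriples N, ∀ h : Point N, (∃ c : ℂ, ∀ s t : ℂ, HasLogDerivAt
      (fun y : Point N => (s • matA y + t • (matA y)ᵀ).det) x h c) →
      HasLogDerivAt (casimirY p) x h 0 := by
    rintro x hx h ⟨c, hc⟩
    obtain ⟨a, v, hav⟩ := exists_coeff_eq_sum_eval N (p + 1)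
    have h1 : casimirY p = fun y => ∑ j, ((if 2 * ((p : ℕ) + 1) = N then 1 / 2 else 1) * a j) *
        ((v j • matA y + (1 : ℂ) • (matA y)ᵀ).det / (matA y).det) := by
      funext y
      rw [casimirY, hav _ (natDegree_formPoly_le y), Finset.sum_div, Finset.mul_sum]
      refine Finset.sum_congr rfl fun j _ => ?_
      rw [eval_formPoly]
      ring
    rw [h1]
    refine HasLogDerivAt.sum_const_mul _ fun j => ?_
    have h2 := hc 1 0
    simp only [one_smul, zero_smul, add_zero] at h2
    simpa only [sub_self] using (hc (v j) 1).div h2 hx.2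
  refine IsCasimirOn.of_hasLogDerivAt isOpen_nondegenerateTriples (fun x hx => ?_) fun x hx v =>
    key x hx _ (exists_hasLogDerivAt_det_form x v)
  -- The zero direction, with zero generator, is used only to read off differentiability.
  refine (key x hx 0 ⟨_, hasLogDerivAt_det_form (α := 0) ?_⟩).differentiableAt
  simp [matA_zero]

theorem isCasimirOn_casimirZ (p : Fin N) : IsCasimirOn (tripleSpace N) (casimirZ p) := by
  have key : ∀ x ∈ tripleSpace N, ∀ h : Point N, (∃ c : ℂ, ∀ t : ℂ, HasLogDerivAt
      (fun y : Point N => (matB y + t • matC y).det) x h c) →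
      HasLogDerivAt (casimirZ p) x h 0 := by
    rintro x hx h ⟨c, hc⟩
    obtain ⟨a, v, hav⟩ := exists_coeff_eq_sum_eval N (p + 1)
    have h1 : casimirZ p = fun y => ∑ j, a j * ((matB y + v j • matC y).det / (matB y).det) := by
      funext y
      rw [casimirZ, hav _ (natDegree_pencilPoly_le y), Finset.sum_div]
      refine Finset.sum_congr rfl fun j _ => ?_
      rw [eval_pencilPoly]
      ring
    rw [h1]
    refine HasLogDerivAt.sum_const_mul _ fun j => ?_
    have h2 := hc 0
    simp only [zero_smul, add_zero] at h2
    simpa only [sub_self] using (hc (v j)).div h2 hx.1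
  refine IsCasimirOn.of_hasLogDerivAt isOpen_tripleSpace (fun x hx => ?_) fun x hx v =>
    key x hx _ (exists_hasLogDerivAt_det_pencil x v)
  refine (key x hx 0 ⟨_, fun t => hasLogDerivAt_det_pencil (L := 0) (R := 0) t ?_⟩).differentiableAt
  simp [matB_zero, matC_zero]

theorem isCasimirOn_casimirX (p : ℕ) (hp : p ≤ N) :
    IsCasimirOn (domainX N p hp) (casimirX p hp) := by
  refine IsCasimirOn.of_hasLogDerivAt (isOpen_domainX p hp) (fun x hx => ?_) ?_
  · refine HasLogDerivAt.differentiableAt (h := 0) (hasLogDerivAt_casimirX_of_fields (s := 0)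
      (c := 0) (dA := 0) (dB := 0) (dC := 0) hx (α := 0) (U := 0) (P := 0) (LB := 0) (RB := 0)
      (L := 0) (R := 0) ?_ ?_ ?_ ?_ ?_ ?_ ?_ ?_ ?_ ?_ ?_ ?_ ?_ ?_)
    all_goals simp [matA_zero, matB_zero, matC_zero]
  · rintro x hx ⟨a, k, l⟩
    fin_cases a
    · exact hasLogDerivAt_casimirX_zero hx k l
    · exact hasLogDerivAt_casimirX_one hx k l
    · exact hasLogDerivAt_casimirX_two hx k l

end Coefficients

/-! ### The expansions defining `Y_p` and `Z_p` -/

section Expansions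

variable {N : ℕ}

/-- Folding at `N / 2`: every index pairs with its reflection except the middle one, which exists
only for even `N`. -/
theorem sum_range_of_symmetric (N : ℕ) (s : ℕ → ℂ) (hs : ∀ k ≤ N, s (N - k) = s k) :
    ∑ k ∈ Finset.range (N + 1), s k =
      ∑ k ∈ Finset.range (N / 2 + 1), if 2 * k = N then s k else 2 * s k := by
  have h1 : ∀ k ∈ Finset.range (N / 2 + 1), (if 2 * k = N then s k else 2 * s k)
      = s k + if 2 * k = N then 0 else s (N - k) := by
    intro k hk
    rw [Finset.mem_range] at hk
    rw [hs k (by omega)]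
    split_ifs <;> ring
  rw [Finset.sum_congr rfl h1, Finset.sum_add_distrib,
    ← Finset.sum_range_add_sum_Ico s (show N / 2 + 1 ≤ N + 1 by omega)]
  congr 1
  simp only [← ite_not (p := 2 * _ = N)]
  rw [← Finset.sum_filter]
  refine Finset.sum_nbij' (N - ·) (N - ·) ?_ ?_ ?_ ?_ ?_
  · intro k hk
    simp only [Finset.mem_Ico, Finset.mem_filter, Finset.mem_range] at hk ⊢
    omega
  · intro k hk
    simp only [Finset.mem_Ico, Finset.mem_filter, Finset.mem_range] at hk ⊢
    omega
  · intro k hk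
    rw [Finset.mem_Ico] at hk
    omega
  · intro k hk
    rw [Finset.mem_filter, Finset.mem_range] at hk
    omega
  · intro k hk
    rw [Finset.mem_Ico] at hk
    rw [Nat.sub_sub_self (by omega)]

/-- Transposition gives `det (T⁻¹𝔸 + 𝔸ᵀ) = T⁻ᴺ det (T𝔸 + 𝔸ᵀ)` for `T ≠ 0`, so the polynomial equals
its own reversal. -/
theorem coeff_formPoly_sub (x : Point N) (k : ℕ) (hk : k ≤ N) :
    (formPoly x).coeff (N - k) = (formPoly x).coeff k := by
  have h : (formPoly x).reflect N = formPoly x := by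
    refine Polynomial.eq_of_infinite_eval_eq _ _ 
      (Set.Infinite.mono ?_ (Set.finite_singleton (0 : ℂ)).infinite_compl)
    intro t ht
    have ht : t ≠ 0 := ht
    have := invertibleOfNonzero (inv_ne_zero ht)
    have h1 := Polynomial.eval₂_reflect_mul_pow (RingHom.id ℂ) t⁻¹ N (formPoly x)
      (natDegree_formPoly_le x)
    simp only [invOf_eq_inv, inv_inv] at h1
    rw [Polynomial.eval₂_id, Polynomial.eval₂_id, eval_formPoly] at h1
    have h2 : t⁻¹ • matA x + (1 : ℂ) • (matA x)ᵀ
        = t⁻¹ • (t • matA x + (1 : ℂ) • (matA x)ᵀ)ᵀ := by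
      rw [one_smul, Matrix.transpose_add, Matrix.transpose_smul, Matrix.transpose_transpose,
        smul_add, smul_smul, inv_mul_cancel₀ ht, add_comm, one_smul]
    rw [h2, Matrix.det_smul, Matrix.det_transpose, Fintype.card_fin, mul_comm] at h1
    have h3 := mul_left_cancel₀ (pow_ne_zero N (inv_ne_zero ht)) h1
    change (Polynomial.reflect N (formPoly x)).eval t = _
    rw [h3, eval_formPoly]
  conv_rhs => rw [← h]
  rw [Polynomial.coeff_reflect, Polynomial.revAt_le hk]

theorem det_form_expansion (hN : 1 ≤ N) (x : Point N) (hA : (matA x).det ≠ 0) (t : ℂ)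
    (ht : t ≠ 0) :
    (t • matA x + t⁻¹ • (matA x)ᵀ).det / (matA x).det
      = (t ^ (N : ℤ) + t ^ (-(N : ℤ)))
        + ∑ p : Fin (N / 2),
            (t ^ ((N : ℤ) - 2 * ((p : ℤ) + 1)) + t ^ (2 * ((p : ℤ) + 1) - (N : ℤ)))
              * casimirY p x := by
  set q : ℕ → ℂ := fun k => (formPoly x).coeff k / (matA x).det with hq
  set s : ℕ → ℂ := fun k => q k * t ^ (2 * (k : ℤ) - N) with hs
  have hq0 : q 0 = 1 := by
    simp only [hq, formPoly, Polynomial.coeff_det_X_add_C_zero, Matrix.det_transpose]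
    exact div_self hA
  have h1 : (t • matA x + t⁻¹ • (matA x)ᵀ).det / (matA x).det
      = ∑ k ∈ Finset.range (N + 1), s k := by
    -- Pulling out `t⁻¹` turns the pencil into `formPoly` at `T = t²`.
    have h2 : t • matA x + t⁻¹ • (matA x)ᵀ
        = t⁻¹ • ((t ^ 2) • matA x + (1 : ℂ) • (matA x)ᵀ) := by
      rw [smul_add, smul_smul, one_smul]
      congr 2
      field_simp
    rw [h2, Matrix.det_smul, Fintype.card_fin, ← eval_formPoly,
      Polynomial.eval_eq_sum_range' (Nat.lt_succ_of_le (natDegree_formPoly_le x)), Finset.mul_sum,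
      Finset.sum_div]
    refine Finset.sum_congr rfl fun k _ => ?_
    simp only [hs, hq]
    rw [zpow_sub₀ ht, zpow_mul, zpow_natCast, zpow_natCast, inv_pow]
    norm_cast
    field_simp
  have h2 : ∑ k ∈ Finset.range (N + 1), s (N - k) = ∑ k ∈ Finset.range (N + 1), s k := by
    exact Finset.sum_range_reflect s (N + 1)
  have hu : ∀ k ≤ N, s k + s (N - k) = q k * (t ^ (2 * (k : ℤ) - N) + t ^ ((N : ℤ) - 2 * k)) := by
    intro k hk
    have h3 : q (N - k) = q k := by simp only [hq, coeff_formPoly_sub x k hk]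
    simp only [hs, h3, Nat.cast_sub hk]
    rw [show 2 * ((N : ℤ) - k) - N = (N : ℤ) - 2 * k by ring]
    ring
  -- The terms `s k` are not symmetric, as the powers of `t` are not; only `s k + s (N - k)` is. The
  -- expansion is therefore proved after doubling both sides.
  have h3 := sum_range_of_symmetric N (fun k => s k + s (N - k)) fun k hk => by
    simp only [Nat.sub_sub_self hk]
    ring
  rw [Finset.sum_add_distrib, h2, Finset.sum_range_succ' _ (N / 2), Finset.sum_range (n := N / 2)] at h3
  rw [h1]
  have h4 : (∑ k ∈ Finset.range (N + 1), s k) * 2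
      = ((t ^ (N : ℤ) + t ^ (-(N : ℤ)))
        + ∑ p : Fin (N / 2),
            (t ^ ((N : ℤ) - 2 * ((p : ℤ) + 1)) + t ^ (2 * ((p : ℤ) + 1) - (N : ℤ)))
              * casimirY p x) * 2 := by
    rw [mul_two, h3, add_mul, add_comm, Finset.sum_mul]
    congr 1
    · rw [if_neg (by omega), hu 0 (Nat.zero_le N), hq0]
      simp
      ring
    · refine Finset.sum_congr rfl fun p _ => ?_
      rw [hu _ (by omega), casimirY]
      push_cast
      split_ifs <;> ring
  exact mul_right_cancel₀ two_ne_zero h4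

theorem det_pencil_expansion (x : Point N) (hB : (matB x).det ≠ 0) (t : ℂ) :
    (matB x + t • matC x).det / (matB x).det
      = 1 + ∑ p : Fin N, t ^ ((p : ℕ) + 1) * casimirZ p x := by
  rw [← eval_pencilPoly, Polynomial.eval_eq_sum_range' (Nat.lt_succ_of_le (natDegree_pencilPoly_le x)),
    Finset.sum_range_succ', Finset.sum_range, add_comm, add_div, Finset.sum_div]
  congr 1
  · simp only [pencilPoly, Polynomial.coeff_det_X_add_C_zero, pow_zero, mul_one]
    exact div_self hB
  · refine Finset.sum_congr rfl fun p _ => ?_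
    rw [casimirZ]
    ring

end Expansions

/-! ### Polynomials over `ℂ` as products of linear factors -/

theorem Polynomial.IsMonicOfDegree.exists_eval_eq_prod {n : ℕ} {p : Polynomial ℂ}
    (hp : p.IsMonicOfDegree n) :
    ∃ r : ℕ → ℂ, ∀ t, p.eval t = ∏ i ∈ Finset.range n, (t - r i) := by
  induction n generalizing p with
  | zero =>
    refine ⟨0, fun t => ?_⟩
    rw [Polynomial.isMonicOfDegree_zero_iff.1 hp]
    simp
  | succ n ih =>
    obtain ⟨a, ha⟩ := IsAlgClosed.exists_root p (by
      rw [Polynomial.degree_eq_natDegree hp.ne_zero, hp.natDegree_eq]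
      exact_mod_cast Nat.succ_ne_zero n)
    obtain ⟨q, rfl⟩ := Polynomial.dvd_iff_isRoot.2 ha
    rw [add_comm] at hp
    obtain ⟨r, hr⟩ := ih ((Polynomial.isMonicOfDegree_X_sub_one a).of_mul_left hp)
    refine ⟨fun i => Nat.casesOn i a r, fun t => ?_⟩
    rw [Finset.prod_range_succ', Polynomial.eval_mul, hr]
    simp [mul_comm]

/-- The polynomials expressing `t ^ (2 n + e) + t ^ (-(2 n + e))`, for `e = 0, 1`, through
`t ^ 2 + t ^ (-2)`. -/
noncomputable def symmetricPoly (e : ℕ) : ℕ → Polynomial ℂ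
  | 0 => Polynomial.C (2 - e)
  | 1 => Polynomial.X - Polynomial.C (e : ℂ)
  | n + 2 => Polynomial.X * symmetricPoly e (n + 1) - symmetricPoly e n

/-- This is the Chebyshev-type recursion obtained by multiplying `t ^ m + t ^ (-m)` by `t ^ 2 + t ^
(-2)`. For odd exponents the factor `t + t⁻¹` splits off first, which accounts for the different
initial values. -/
theorem eval_symmetricPoly (e : ℕ) (he : e < 2) (t : ℂ) (ht : t ≠ 0) : ∀ n : ℕ,
    t ^ (2 * (n : ℤ) + e) + t ^ (-(2 * (n : ℤ) + e))
      = (t + t⁻¹) ^ e * (symmetricPoly e n).eval (t ^ 2 + (t⁻¹) ^ 2)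
  | 0 => by
    interval_cases e
    · simp [symmetricPoly]; norm_num
    · simp [symmetricPoly]; norm_num
  | 1 => by
    interval_cases e
    · simp [symmetricPoly]
    · simp [symmetricPoly]
      norm_cast
      field_simp
      ring
  | n + 2 => by
    have h1 := eval_symmetricPoly e he t ht (n + 1)
    have h0 := eval_symmetricPoly e he t ht n
    rw [symmetricPoly, Polynomial.eval_sub, Polynomial.eval_mul, Polynomial.eval_X, mul_sub,
      mul_left_comm, ← h1, ← h0]
    push_cast
    have e1 : t ^ (2 * ((n : ℤ) + 2) + e) = t ^ (2 * (n : ℤ) + e) * t ^ 4 := by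
      rw [← zpow_natCast t 4, ← zpow_add₀ ht]; congr 1; push_cast; ring
    have e2 : t ^ (2 * ((n : ℤ) + 1) + e) = t ^ (2 * (n : ℤ) + e) * t ^ 2 := by
      rw [← zpow_natCast t 2, ← zpow_add₀ ht]; congr 1; push_cast; ring
    rw [zpow_neg, zpow_neg, zpow_neg, e1, e2]
    have := zpow_ne_zero (2 * (n : ℤ) + e) ht
    field_simp
    ring

theorem isMonicOfDegree_symmetricPoly_succ (e : ℕ) : ∀ n : ℕ,
    (symmetricPoly e (n + 1)).IsMonicOfDegree (n + 1)
  | 0 => Polynomial.isMonicOfDegree_X_sub_one _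
  | 1 => by
    have h := (Polynomial.isMonicOfDegree_X ℂ).mul (isMonicOfDegree_symmetricPoly_succ e 0)
    refine Polynomial.IsMonicOfDegree.sub h ?_
    rw [symmetricPoly, Polynomial.natDegree_C]
    exact two_pos
  | n + 2 => by
    have h := (Polynomial.isMonicOfDegree_X ℂ).mul (isMonicOfDegree_symmetricPoly_succ e (n + 1))
    rw [add_comm 1] at h
    refine Polynomial.IsMonicOfDegree.sub h ?_
    rw [(isMonicOfDegree_symmetricPoly_succ e n).natDegree_eq]
    omega

theorem natDegree_symmetricPoly_le (e n : ℕ) : (symmetricPoly e n).natDegree ≤ n := by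
  cases n with
  | zero => rw [symmetricPoly, Polynomial.natDegree_C]
  | succ n => exact (isMonicOfDegree_symmetricPoly_succ e n).natDegree_eq.le

/-- The only delicate case is `N / 2 = 0`, where `N = 1` and the constant is `2 - 1 = 1`; for `N =
0` it would be `2`. -/
theorem isMonicOfDegree_symmetricPoly_half {N : ℕ} (hN : 1 ≤ N) :
    (symmetricPoly (N % 2) (N / 2)).IsMonicOfDegree (N / 2) := by
  rcases Nat.eq_zero_or_pos (N / 2) with h | h
  · have : N % 2 = 1 := by omega
    rw [h, this, symmetricPoly, Polynomial.isMonicOfDegree_zero_iff]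
    norm_num
  · obtain ⟨k, hk⟩ := Nat.exists_eq_succ_of_ne_zero h.ne'
    rw [hk]
    exact isMonicOfDegree_symmetricPoly_succ _ k

theorem Polynomial.IsMonicOfDegree.add_sum {n : ℕ} {p : Polynomial ℂ} (hp : p.IsMonicOfDegree n)
    {ι : Type*} [Fintype ι] (q : ι → Polynomial ℂ) (hq : ∀ i, (q i).natDegree < n) :
    (p + ∑ i, q i).IsMonicOfDegree n := by
  rcases isEmpty_or_nonempty ι with h | ⟨⟨i⟩⟩
  · simpa using hp
  · refine hp.add_right ?_
    refine lt_of_le_of_lt (Polynomial.natDegree_sum_le_of_forall_le (n := n - 1) _ _ fun i _ => ?_) ?_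
    · have := hq i; omega
    · have := hq i; omega

/-- The right-hand side of the expansion defining `Y_p` factors for any values of the `Y_p`. -/
theorem exists_form_factorization {N : ℕ} (hN : 1 ≤ N) (y : Fin (N / 2) → ℂ) :
    ∃ r : ℕ → ℂ, ∀ t : ℂ, t ≠ 0 →
      (t ^ (N : ℤ) + t ^ (-(N : ℤ))) + ∑ p : Fin (N / 2),
          (t ^ ((N : ℤ) - 2 * ((p : ℤ) + 1)) + t ^ (2 * ((p : ℤ) + 1) - (N : ℤ))) * y p
        = (t + t⁻¹) ^ (N % 2) * ∏ i ∈ Finset.range (N / 2), (t ^ 2 + (t⁻¹) ^ 2 - r i) := by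
  obtain ⟨r, hr⟩ := ((isMonicOfDegree_symmetricPoly_half hN).add_sum
    (fun p : Fin (N / 2) => Polynomial.C (y p) * symmetricPoly (N % 2) (N / 2 - (p + 1)))
    fun p => lt_of_le_of_lt ((Polynomial.natDegree_C_mul_le _ _).trans
      (natDegree_symmetricPoly_le _ _)) (by omega)).exists_eval_eq_prod
  refine ⟨r, fun t ht => ?_⟩
  have h := eval_symmetricPoly (N % 2) (Nat.mod_lt _ two_pos) t ht
  rw [← hr, Polynomial.eval_add, mul_add, ← h, Polynomial.eval_finsetSum, Finset.mul_sum]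
  have e0 : 2 * ((N / 2 : ℕ) : ℤ) + ((N % 2 : ℕ) : ℤ) = N := by omega
  rw [e0]
  congr 1
  refine Finset.sum_congr rfl fun p _ => ?_
  rw [Polynomial.eval_mul, Polynomial.eval_C, mul_left_comm, ← h, mul_comm (y p)]
  have e1 : 2 * ((N / 2 - ((p : ℕ) + 1) : ℕ) : ℤ) + ((N % 2 : ℕ) : ℤ)
      = (N : ℤ) - 2 * ((p : ℤ) + 1) := by omega
  rw [e1, neg_sub]

/-- The reversed polynomial is monic of degree `N`, so its negated roots are the `μ i`. Its constant
term is the last `z`, whose nonvanishing keeps all `μ i` away from zero. -/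
theorem exists_pencil_factorization {N : ℕ} (z : Fin N → ℂ) (hz : ∀ p : Fin N, (p : ℕ) + 1 = N → z p ≠ 0) :
    ∃ μ : ℕ → ℂ, (∀ i < N, μ i ≠ 0) ∧ ∀ t : ℂ,
      1 + ∑ p : Fin N, t ^ ((p : ℕ) + 1) * z p = ∏ i ∈ Finset.range N, (1 + t * μ i) := by
  obtain ⟨r, hr⟩ := ((Polynomial.isMonicOfDegree_X_pow ℂ N).add_sum
    (fun p : Fin N => Polynomial.C (z p) * Polynomial.X ^ (N - 1 - p))
    fun p => lt_of_le_of_lt (Polynomial.natDegree_C_mul_X_pow_le _ _) (by omega)).exists_eval_eq_prod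
  simp only [Polynomial.eval_add, Polynomial.eval_finsetSum, Polynomial.eval_mul,
    Polynomial.eval_C, Polynomial.eval_pow, Polynomial.eval_X] at hr
  refine ⟨fun i => -r i, fun i hi => ?_, fun t => ?_⟩
  · intro h0
    have h1 := hr 0
    rw [Finset.prod_eq_zero (Finset.mem_range.2 hi) (by rw [zero_sub]; exact h0),
      zero_pow (by omega), zero_add,
      Finset.sum_eq_single (⟨N - 1, by omega⟩ : Fin N)] at h1
    · simp only [Nat.sub_self, pow_zero, mul_one] at h1
      exact hz _ (by simp only; omega) h1
    · intro b _ hb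
      rw [zero_pow, mul_zero]
      intro h2
      exact hb (Fin.ext (by simp only; omega))
    · simp
  · rcases eq_or_ne t 0 with rfl | ht
    · simp
    · have h1 := congrArg (t ^ N * ·) (hr t⁻¹)
      have h2 : t ^ N = ∏ _i ∈ Finset.range N, t := by simp
      refine Eq.trans ?_ (h1.trans ?_)
      · rw [mul_add, inv_pow, mul_inv_cancel₀ (pow_ne_zero _ ht), Finset.mul_sum]
        congr 1
        refine Finset.sum_congr rfl fun p _ => ?_
        have e : t ^ N = t ^ ((p : ℕ) + 1) * t ^ (N - 1 - (p : ℕ)) := by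
          rw [← pow_add]; congr 1; omega
        rw [e, inv_pow]
        field_simp
      · simp only
        rw [h2, ← Finset.prod_mul_distrib]
        refine Finset.prod_congr rfl fun i _ => ?_
        field_simp
        ring

/-! ### Matrices supported on the two diagonals -/

theorem Fin.prod_univ_eq_prod_pairs {N : ℕ} (hN : 1 ≤ N) (f : Fin N → ℂ) :
    ∏ i, f i = (∏ p : Fin (N / 2), f ⟨p, by omega⟩ * f ⟨N - 1 - p, by omega⟩)
      * (if N % 2 = 1 then f ⟨N / 2, by omega⟩ else 1) := by
  set F : ℕ → ℂ := fun k => if h : k < N then f ⟨k, h⟩ else 1 with hF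
  have hf : ∀ (k : ℕ) (hk : k < N), f ⟨k, hk⟩ = F k := fun k hk => by simp [hF, hk]
  simp only [hf]
  rw [← Finset.prod_range F, Finset.prod_mul_distrib, ← Finset.prod_range (fun k => F k),
    ← Finset.prod_range (fun k => F (N - 1 - k))]
  have h2 : ∏ k ∈ Finset.range N, F k = ∏ k ∈ Finset.range (N / 2 + N % 2 + N / 2), F k := by
    congr 2
    omega
  have h3 : ∏ k ∈ Finset.range (N / 2), F (N - 1 - k)
      = ∏ k ∈ Finset.range (N / 2), F (N / 2 + N % 2 + k) := by
    rw [← Finset.prod_range_reflect]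
    refine Finset.prod_congr rfl fun k hk => ?_
    rw [Finset.mem_range] at hk
    congr 1
    omega
  rw [h2, h3, Finset.prod_range_add, Finset.prod_range_add, mul_right_comm]
  congr 2
  rcases Nat.mod_two_eq_zero_or_one N with h | h <;> simp [h]

theorem Fin.val_rev' {N : ℕ} (i : Fin N) : (i.rev : ℕ) = N - 1 - i := by
  rw [Fin.val_rev]
  omega

/-- The determinant of a matrix supported on the diagonal and the antidiagonal. -/
theorem det_of_support_diagonals {N : ℕ} (hN : 1 ≤ N) (M : Matrix (Fin N) (Fin N) ℂ)
    (hM : ∀ i j, j ≠ i → j ≠ i.rev → M i j = 0)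
    (h0 : ∀ i : Fin N, i < i.rev → M i.rev i.rev ≠ 0) :
    M.det = (∏ p : Fin (N / 2),
        (M ⟨p, by omega⟩ ⟨p, by omega⟩ * M ⟨N - 1 - p, by omega⟩ ⟨N - 1 - p, by omega⟩
          - M ⟨p, by omega⟩ ⟨N - 1 - p, by omega⟩ * M ⟨N - 1 - p, by omega⟩ ⟨p, by omega⟩))
      * (if N % 2 = 1 then M ⟨N / 2, by omega⟩ ⟨N / 2, by omega⟩ else 1) := by
  -- Multiplying on the right by the unipotent `V` clears the lower half of the antidiagonal with
  -- the lower diagonal entries as pivots; those are the only entries required to be nonzero.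
  set V : Matrix (Fin N) (Fin N) ℂ := Matrix.of fun i j =>
    if i = j then 1 else if i = j.rev ∧ j < i then -(M i j / M i i) else 0 with hV
  have hVdet : V.det = 1 := by
    rw [Matrix.det_of_isLowerTriangular V]
    · simp [hV]
    · intro i j hij
      have hij : i < j := hij
      simp [hV, hij.ne, hij.not_gt]
  have hMV : ∀ i j, (M * V) i j = M i j + if j < j.rev then M i j.rev * V j.rev j else 0 := by
    intro i j
    rw [Matrix.mul_apply]
    split_ifs with h
    · rw [← Finset.sum_subset (Finset.subset_univ {j, j.rev}), Finset.sum_pair h.ne]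
      · simp [hV]
      · intro k _ hk
        simp only [Finset.mem_insert, Finset.mem_singleton, not_or] at hk
        simp [hV, hk.1, hk.2]
    · rw [Finset.sum_eq_single j]
      · simp [hV]
      · intro k _ hk
        have : ¬ (k = j.rev ∧ j < k) := by rintro ⟨rfl, h'⟩; exact h h'
        simp [hV, hk, this]
      · simp
  have htri : (M * V).IsUpperTriangular := by
    intro i j hij
    have hij : j < i := hij
    rw [hMV]
    by_cases hr : i = j.rev
    · subst hr
      rw [if_pos hij]
      simp only [hV, Matrix.of_apply, if_neg hij.ne', true_and, if_pos hij]
      have := h0 j hij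
      field_simp
      ring
    · rw [hM i j hij.ne (fun h => hr (by rw [h, Fin.rev_rev])), zero_add]
      split_ifs with h
      · rw [hM i j.rev (Ne.symm hr) (fun h' => hij.ne (Fin.rev_injective h')), zero_mul]
      · rfl
  have hdet : M.det = (M * V).det := by rw [Matrix.det_mul, hVdet, mul_one]
  rw [hdet, Matrix.det_of_isUpperTriangular htri, Fin.prod_univ_eq_prod_pairs hN]
  have hrev : ∀ p : Fin (N / 2), Fin.rev (⟨p, by omega⟩ : Fin N) = ⟨N - 1 - p, by omega⟩ :=
    fun p => Fin.ext (Fin.val_rev' _)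
  have hrev' : ∀ p : Fin (N / 2), Fin.rev (⟨N - 1 - p, by omega⟩ : Fin N) = ⟨p, by omega⟩ :=
    fun p => by rw [← hrev, Fin.rev_rev]
  congr 1
  · refine Finset.prod_congr rfl fun p _ => ?_
    have hlt : (⟨p, by omega⟩ : Fin N) < ⟨N - 1 - p, by omega⟩ := by
      rw [Fin.lt_def]; simp only; omega
    have h1 := h0 ⟨p, by omega⟩ (by rw [hrev]; exact hlt)
    rw [hrev] at h1
    rw [hMV, hMV, hrev, hrev', if_pos hlt, if_neg hlt.not_gt]
    simp only [hV, Matrix.of_apply, if_neg hlt.ne', hrev, true_and, if_pos hlt]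
    field_simp
    ring
  · split_ifs with h
    · rw [hMV, if_neg, add_zero]
      rw [Fin.lt_def, Fin.val_rev']
      simp only
      omega
    · rfl

/-- The matrix with diagonal `d` and with `e` on the upper half of the antidiagonal. -/
def crossMatrix (N : ℕ) (d e : ℕ → ℂ) : Matrix (Fin N) (Fin N) ℂ :=
  Matrix.of fun i j => if j = i then d i else if j = i.rev ∧ i < j then e i else 0

/-- The matrix with `1` on the antidiagonal. -/
def flipMatrix (N : ℕ) : Matrix (Fin N) (Fin N) ℂ :=
  Matrix.of fun i j => if j = i.rev then 1 else 0

section Cross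

variable {N : ℕ} (d e : ℕ → ℂ)

theorem crossMatrix_diag (i : Fin N) : crossMatrix N d e i i = d i := by simp [crossMatrix]

theorem crossMatrix_of_lt (i j : Fin N) (hij : j < i) : crossMatrix N d e i j = 0 := by
  simp [crossMatrix, hij.ne, hij.not_gt]

theorem crossMatrix_eq_zero (i j : Fin N) (h1 : j ≠ i) (h2 : j ≠ i.rev) :
    crossMatrix N d e i j = 0 := by
  simp [crossMatrix, h1, h2]

theorem crossMatrix_rev (i : Fin N) (h : i < i.rev) : crossMatrix N d e i i.rev = e i := by
  simp [crossMatrix, h, h.ne']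

theorem crossMatrix_isUpperTriangular : (crossMatrix N d e).IsUpperTriangular :=
  fun i j hij => crossMatrix_of_lt d e i j hij

theorem det_crossMatrix : (crossMatrix N d e).det = ∏ i ∈ Finset.range N, d i := by
  rw [Matrix.det_of_isUpperTriangular (crossMatrix_isUpperTriangular d e), Finset.prod_range]
  exact Finset.prod_congr rfl fun i _ => crossMatrix_diag d e i

theorem mul_flipMatrix_apply (M : Matrix (Fin N) (Fin N) ℂ) (i j : Fin N) :
    (M * flipMatrix N) i j = M i j.rev := by
  rw [Matrix.mul_apply, Finset.sum_eq_single j.rev]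
  · simp [flipMatrix]
  · intro k _ hk
    have : j ≠ k.rev := fun h => hk (by rw [h, Fin.rev_rev])
    simp [flipMatrix, this]
  · simp

theorem flipMatrix_mul_self : flipMatrix N * flipMatrix N = 1 := by
  ext i j
  rw [mul_flipMatrix_apply]
  simp [flipMatrix, Matrix.one_apply, eq_comm]

theorem det_flipMatrix_ne_zero : (flipMatrix N).det ≠ 0 := by
  intro h
  have := congrArg Matrix.det (flipMatrix_mul_self (N := N))
  rw [Matrix.det_mul, h, Matrix.det_one, zero_mul] at this
  exact zero_ne_one this

theorem upperRightMinor_flipMatrix (q : ℕ) (hq : q ≤ N) :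
    upperRightMinor (flipMatrix N) q hq = (flipMatrix q).det := by
  rw [upperRightMinor]
  congr 1
  ext i j
  simp only [flipMatrix, Matrix.submatrix_apply, Matrix.of_apply, Fin.ext_iff, Fin.val_rev',
    Fin.val_castLE]
  have : (N - q + (j : ℕ) = N - 1 - i) ↔ ((j : ℕ) = q - 1 - i) := by omega
  simp only [this]

/-- The first `q` rows of `L` vanish beyond column `q`, so the leading block of the product is the
product of the leading blocks. -/
theorem upperLeftMinor_mul_of_triangular {L U : Matrix (Fin N) (Fin N) ℂ}
    (hL : L.IsLowerTriangular) (hU : U.IsUpperTriangular) (q : ℕ) (hq : q ≤ N) :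
    upperLeftMinor (L * U) q hq =
      ∏ i : Fin q, (L (Fin.castLE hq i) (Fin.castLE hq i) * U (Fin.castLE hq i) (Fin.castLE hq i)) := by
  have h1 : (L * U).submatrix (Fin.castLE hq) (Fin.castLE hq)
      = L.submatrix (Fin.castLE hq) (Fin.castLE hq) * U.submatrix (Fin.castLE hq) (Fin.castLE hq) := by
    ext i j
    simp only [Matrix.submatrix_apply, Matrix.mul_apply]
    refine (Fintype.sum_of_injective _ (Fin.castLE_injective hq) _ _ ?_ fun k => rfl).symm
    intro k hk
    rw [mem_range_castLE] at hk
    have hlt : Fin.castLE hq i < k := by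
      rw [Fin.lt_def, Fin.val_castLE]
      omega
    have : L (Fin.castLE hq i) k = 0 := hL hlt
    rw [this, zero_mul]
  rw [upperLeftMinor, h1, Matrix.det_mul, Matrix.det_of_isLowerTriangular,
    Matrix.det_of_isUpperTriangular, Finset.prod_mul_distrib]
  · rfl
  · intro i j hij
    exact hU hij
  · intro i j hij
    exact hL hij

end Cross

/-! ### Points with prescribed values of the Casimir functions -/

/-- The triple with given matrices. -/
def ofMatrices {N : ℕ} (A B C : Matrix (Fin N) (Fin N) ℂ) : Point N :=
  fun u => (![A, B, C] u.1) u.2.1 u.2.2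

section SpecialPoint

variable {N : ℕ}

theorem matA_ofMatrices (A B C : Matrix (Fin N) (Fin N) ℂ) : matA (ofMatrices A B C) = A := rfl

theorem matB_ofMatrices (A B C : Matrix (Fin N) (Fin N) ℂ) : matB (ofMatrices A B C) = B := rfl

theorem matC_ofMatrices (A B C : Matrix (Fin N) (Fin N) ℂ) : matC (ofMatrices A B C) = C := rfl

/-- Each pair of opposite indices contributes a `2 × 2` block with diagonal entries `t + t⁻¹` and
off-diagonal entries `t σ`, `t⁻¹ σ`, hence the factor `(t + t⁻¹)² - σ²`. The middle index of an odd
`N` gives the extra `t + t⁻¹`. -/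
theorem det_form_crossMatrix (hN : 1 ≤ N) (σ : ℕ → ℂ) (t : ℂ) (ht : t ≠ 0) (h0 : t + t⁻¹ ≠ 0) :
    (t • crossMatrix N 1 σ + t⁻¹ • (crossMatrix N 1 σ)ᵀ).det
      = (t + t⁻¹) ^ (N % 2)
        * ∏ i ∈ Finset.range (N / 2), (t ^ 2 + (t⁻¹) ^ 2 - (σ i ^ 2 - 2)) := by
  set M := t • crossMatrix N 1 σ + t⁻¹ • (crossMatrix N 1 σ)ᵀ with hM
  have hMa : ∀ i j, M i j = t * crossMatrix N 1 σ i j + t⁻¹ * crossMatrix N 1 σ j i :=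
    fun i j => rfl
  have hd : ∀ i, M i i = t + t⁻¹ := fun i => by simp [hMa, crossMatrix_diag]
  have hrev : ∀ p : Fin (N / 2), Fin.rev (⟨p, by omega⟩ : Fin N) = ⟨N - 1 - p, by omega⟩ :=
    fun p => Fin.ext (Fin.val_rev' _)
  rw [det_of_support_diagonals hN M ?_ fun i _ => by rw [hd]; exact h0, mul_comm,
    Finset.prod_range]
  · congr 1
    · rcases Nat.mod_two_eq_zero_or_one N with h | h <;> simp [h, hd]
    · refine Finset.prod_congr rfl fun p _ => ?_
      have hlt : (⟨p, by omega⟩ : Fin N) < ⟨N - 1 - p, by omega⟩ := by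
        rw [Fin.lt_def]; simp only; omega
      have h1 := crossMatrix_rev 1 σ (⟨p, by omega⟩ : Fin N) (by rw [hrev]; exact hlt)
      rw [hrev] at h1
      rw [hd, hd, hMa, hMa, h1, crossMatrix_of_lt _ _ _ _ hlt]
      field_simp
      ring
  · intro i j h1 h2
    rw [hMa, crossMatrix_eq_zero _ _ _ _ h1 h2, crossMatrix_eq_zero _ _ _ _ h1.symm
      (fun h => h2 (by rw [h, Fin.rev_rev]))]
    simp

/-- After the flip, the block of a pair has trace `μ_i + μ_{N-1-i}` and determinant `-g_i
g_{N-1-i}`. The hypothesis on the products makes its eigenvalues the two `μ`, while the ratio of the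
two `g` stays free for `X_p`. -/
theorem det_one_add_crossMatrix_mul_flipMatrix (hN : 1 ≤ N) (g μ : ℕ → ℂ)
    (hg : ∀ i < N / 2, g i * g (N - 1 - i) = -(μ i * μ (N - 1 - i)))
    (hmid : N % 2 = 1 → g (N / 2) = μ (N / 2)) (t : ℂ) :
    (1 + t • (crossMatrix N g (fun i => μ i + μ (N - 1 - i)) * flipMatrix N)).det
      = ∏ i ∈ Finset.range N, (1 + t * μ i) := by
  set G := crossMatrix N g (fun i => μ i + μ (N - 1 - i)) with hG
  set M := 1 + t • (G * flipMatrix N) with hM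
  have hMa : ∀ i j, M i j = (if i = j then 1 else 0) + t * G i j.rev := fun i j => by
    rw [← mul_flipMatrix_apply G]
    rfl
  have hrev : ∀ p : Fin (N / 2), Fin.rev (⟨p, by omega⟩ : Fin N) = ⟨N - 1 - p, by omega⟩ :=
    fun p => Fin.ext (Fin.val_rev' _)
  have hrev' : ∀ p : Fin (N / 2), Fin.rev (⟨N - 1 - p, by omega⟩ : Fin N) = ⟨p, by omega⟩ :=
    fun p => by rw [← hrev, Fin.rev_rev]
  have hlow : ∀ i : Fin N, i < i.rev → M i.rev i.rev = 1 := fun i hi => by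
    rw [hMa, if_pos rfl, Fin.rev_rev, hG, crossMatrix_of_lt _ _ _ _ hi, mul_zero, add_zero]
  rw [det_of_support_diagonals hN M ?_ fun i hi => by rw [hlow i hi]; exact one_ne_zero,
    Finset.prod_range, Fin.prod_univ_eq_prod_pairs hN]
  · congr 1
    · refine Finset.prod_congr rfl fun p _ => ?_
      have hlt : (⟨p, by omega⟩ : Fin N) < ⟨N - 1 - p, by omega⟩ := by
        rw [Fin.lt_def]; simp only; omega
      have h1 := crossMatrix_rev g (fun i => μ i + μ (N - 1 - i)) (⟨p, by omega⟩ : Fin N)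
        (by rw [hrev]; exact hlt)
      have h2 := hlow ⟨p, by omega⟩ (by rw [hrev]; exact hlt)
      rw [hrev] at h1 h2
      rw [h2, hMa, hMa, hMa, hrev, hrev', if_pos rfl, if_neg hlt.ne, if_neg hlt.ne', hG, h1,
        crossMatrix_diag, crossMatrix_diag]
      simp only
      linear_combination -t ^ 2 * hg p p.2
    · split_ifs with h
      · have hr : Fin.rev (⟨N / 2, by omega⟩ : Fin N) = ⟨N / 2, by omega⟩ :=
          Fin.ext (by rw [Fin.val_rev']; simp only; omega)
        rw [hMa, if_pos rfl, hr, hG, crossMatrix_diag, hmid h]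
      · rfl
  · intro i j h1 h2
    rw [hMa, if_neg h1.symm, hG, crossMatrix_eq_zero]
    · simp
    · exact fun h => h2 (by rw [← h, Fin.rev_rev])
    · exact fun h => h1 (Fin.rev_injective h)

theorem matS_ofMatrices_inv {A G C : Matrix (Fin N) (Fin N) ℂ} (hG : G.det ≠ 0) :
    matS (ofMatrices A G⁻¹ C) = Aᵀ * G := by
  rw [matS, matA_ofMatrices, matB_ofMatrices,
    Matrix.nonsing_inv_nonsing_inv _ (isUnit_iff_ne_zero.2 hG)]

theorem det_crossMatrix_ne_zero {g : ℕ → ℂ} (θ : ℕ → ℂ) (hg : ∀ i < N, g i ≠ 0) :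
    (crossMatrix N g θ).det ≠ 0 := by
  rw [det_crossMatrix]
  exact Finset.prod_ne_zero_iff.2 fun i hi => hg i (Finset.mem_range.1 hi)

theorem ofMatrices_mem_regularTriples {g : ℕ → ℂ} (σ θ : ℕ → ℂ) (hg : ∀ i < N, g i ≠ 0) :
    ofMatrices (crossMatrix N 1 σ) (crossMatrix N g θ)⁻¹ (flipMatrix N) ∈ regularTriples N := by
  have hG := det_crossMatrix_ne_zero θ hg
  refine ⟨⟨⟨?_, det_flipMatrix_ne_zero⟩, ?_⟩, fun q hq => ?_⟩
  · exact (Matrix.isUnit_nonsing_inv_det _ (isUnit_iff_ne_zero.2 hG)).ne_zero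
  · exact det_crossMatrix_ne_zero σ fun i _ => one_ne_zero
  · rw [matC_ofMatrices, upperRightMinor_flipMatrix]
    exact det_flipMatrix_ne_zero

/-- Here `S` is lower triangular with unit diagonal times upper triangular, so its leading minors
are initial products of `g`. Dividing by the full product `det B⁻¹` leaves the ratios of paired
entries. -/
theorem casimirX_ofMatrices {g : ℕ → ℂ} (σ θ : ℕ → ℂ) (hg : ∀ i < N, g i ≠ 0)
    (p : ℕ) (hp : p ≤ N) :
    casimirX p hp (ofMatrices (crossMatrix N 1 σ) (crossMatrix N g θ)⁻¹ (flipMatrix N))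
      = (flipMatrix N).det / ((flipMatrix (N - p)).det * (flipMatrix p).det)
        * ∏ i ∈ Finset.range p, (g i / g (N - 1 - i)) := by
  have hG := det_crossMatrix_ne_zero θ hg
  have hu : ∀ (q : ℕ) (hq : q ≤ N), upperLeftMinor ((crossMatrix N 1 σ)ᵀ * crossMatrix N g θ) q hq
      = ∏ i ∈ Finset.range q, g i := by
    intro q hq
    rw [upperLeftMinor_mul_of_triangular _ (crossMatrix_isUpperTriangular g θ), Finset.prod_range]
    · refine Finset.prod_congr rfl fun i _ => ?_
      rw [Matrix.transpose_apply, crossMatrix_diag, crossMatrix_diag, Pi.one_apply, one_mul]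
      rfl
    · intro i j hij
      exact crossMatrix_of_lt 1 σ j i hij
  have hN : ∏ i ∈ Finset.range N, g i
      = (∏ i ∈ Finset.range (N - p), g i) * ∏ i ∈ Finset.range p, g (N - 1 - i) := by
    conv_lhs => rw [← Nat.sub_add_cancel hp]
    rw [Finset.prod_range_add, ← Finset.prod_range_reflect _ p]
    congr 1
    refine Finset.prod_congr rfl fun i hi => ?_
    rw [Finset.mem_range] at hi
    congr 1
    omega
  have hA : (crossMatrix N 1 σ).det = 1 := by simp [det_crossMatrix]
  rw [casimirX, matS_ofMatrices_inv hG, hu, hu, matA_ofMatrices, matB_ofMatrices, matC_ofMatrices,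
    upperRightMinor_flipMatrix, upperRightMinor_flipMatrix, Matrix.det_nonsing_inv,
    Ring.inverse_eq_inv', det_crossMatrix g θ, hA, hN, Finset.prod_div_distrib]
  have h1 : ∏ i ∈ Finset.range (N - p), g i ≠ 0 :=
    Finset.prod_ne_zero_iff.2 fun i hi => hg i (by rw [Finset.mem_range] at hi; omega)
  have h2 : ∏ i ∈ Finset.range p, g (N - 1 - i) ≠ 0 :=
    Finset.prod_ne_zero_iff.2 fun i hi => hg _ (by rw [Finset.mem_range] at hi; omega)
  field_simp

/-- Multiplying by `t ^ N` gives polynomial identities. An infinite set of `t` suffices, and is what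
is available, since the block computation of the determinant excludes `t + t⁻¹ = 0`. -/
theorem eq_of_form_expansion_eq {y y' : Fin (N / 2) → ℂ} {s : Set ℂ} (hs : s.Infinite)
    (hs0 : ∀ t ∈ s, t ≠ 0)
    (h : ∀ t ∈ s, ∑ p : Fin (N / 2),
        (t ^ ((N : ℤ) - 2 * ((p : ℤ) + 1)) + t ^ (2 * ((p : ℤ) + 1) - (N : ℤ))) * y p
      = ∑ p : Fin (N / 2),
        (t ^ ((N : ℤ) - 2 * ((p : ℤ) + 1)) + t ^ (2 * ((p : ℤ) + 1) - (N : ℤ))) * y' p) :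
    y = y' := by
  set Q : (Fin (N / 2) → ℂ) → Polynomial ℂ := fun y => ∑ p : Fin (N / 2),
    Polynomial.C (y p) * (Polynomial.X ^ (2 * (N - (p + 1))) + Polynomial.X ^ (2 * ((p : ℕ) + 1)))
    with hQ
  have heval : ∀ (y : Fin (N / 2) → ℂ) (t : ℂ), t ≠ 0 → (Q y).eval t = t ^ N * ∑ p : Fin (N / 2),
      (t ^ ((N : ℤ) - 2 * ((p : ℤ) + 1)) + t ^ (2 * ((p : ℤ) + 1) - (N : ℤ))) * y p := by
    intro y t ht
    simp only [hQ, Polynomial.eval_finsetSum, Polynomial.eval_mul, Polynomial.eval_add,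
      Polynomial.eval_C, Polynomial.eval_pow, Polynomial.eval_X, Finset.mul_sum]
    refine Finset.sum_congr rfl fun p _ => ?_
    rw [← mul_assoc, mul_add (t ^ N), ← zpow_natCast t N, ← zpow_add₀ ht, ← zpow_add₀ ht,
      ← zpow_natCast t, ← zpow_natCast t, mul_comm (y p)]
    congr 3 <;> omega
  have hpoly : Q y = Q y' := Polynomial.eq_of_infinite_eval_eq _ _ (hs.mono fun t ht => by
    change (Q y).eval t = (Q y').eval t
    rw [heval y t (hs0 t ht), heval y' t (hs0 t ht), h t ht])
  have hcoeff : ∀ (y : Fin (N / 2) → ℂ) (p : Fin (N / 2)), (Q y).coeff (2 * ((p : ℕ) + 1))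
      = y p * ((if 2 * ((p : ℕ) + 1) = N then 1 else 0) + 1) := by
    intro y p
    simp only [hQ, Polynomial.finsetSum_coeff, Polynomial.coeff_C_mul, Polynomial.coeff_add,
      Polynomial.coeff_X_pow]
    rw [Finset.sum_eq_single p]
    · congr 2
      · congr 1
        exact propext (by omega)
      · simp
    · intro b _ hb
      have hb' : (b : ℕ) ≠ p := fun h => hb (Fin.ext h)
      rw [if_neg (by omega), if_neg (by omega), add_zero, mul_zero]
    · simp
  funext p
  have h1 := congrArg (fun q => Polynomial.coeff q (2 * ((p : ℕ) + 1))) hpoly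
  simp only [hcoeff] at h1
  refine mul_right_cancel₀ ?_ h1
  split_ifs <;> norm_num

theorem eq_of_pencil_expansion_eq {z z' : Fin N → ℂ}
    (h : ∀ t : ℂ, ∑ p : Fin N, t ^ ((p : ℕ) + 1) * z p = ∑ p : Fin N, t ^ ((p : ℕ) + 1) * z' p) :
    z = z' := by
  have hpoly : ∑ p : Fin N, Polynomial.C (z p) * Polynomial.X ^ ((p : ℕ) + 1)
      = ∑ p : Fin N, Polynomial.C (z' p) * Polynomial.X ^ ((p : ℕ) + 1) := by
    refine Polynomial.funext fun t => ?_
    simp only [Polynomial.eval_finsetSum, Polynomial.eval_mul, Polynomial.eval_C,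
      Polynomial.eval_pow, Polynomial.eval_X, mul_comm (z _), mul_comm (z' _)]
    exact h t
  funext p
  have h1 := congrArg (fun q => Polynomial.coeff q ((p : ℕ) + 1)) hpoly
  simpa [Polynomial.finsetSum_coeff, Polynomial.coeff_X_pow, Fin.val_inj] using h1

theorem prod_range_div_of_ne_zero {τ : ℕ → ℂ} (hτ : ∀ k, τ k ≠ 0) (n : ℕ) :
    ∏ i ∈ Finset.range n, τ (i + 1) / τ i = τ n / τ 0 := by
  induction n with
  | zero => simp [hτ]
  | succ n ih =>
    rw [Finset.prod_range_succ, ih, mul_comm, div_mul_div_cancel₀ (hτ n)]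

/-- Factoring the prescribed expansions gives `r` and `μ`. The antidiagonal `σ` then realises `r`,
and for each pair the product of the two `g` is dictated by `μ` and their ratio by `x`; square roots
in `ℂ` solve for both. -/
theorem exists_regular_point_of_values (hN : 1 ≤ N) (y x : Fin (N / 2) → ℂ) (z : Fin N → ℂ)
    (hx : ∀ p, x p ≠ 0) (hz : ∀ p : Fin N, (p : ℕ) + 1 = N → z p ≠ 0) :
    ∃ P ∈ regularTriples N, (∀ p, casimirY p P = y p) ∧
      (∀ p : Fin (N / 2), casimirX (p + 1) (label_le p) P = x p) ∧ ∀ p, casimirZ p P = z p := by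
  obtain ⟨r, hr⟩ := exists_form_factorization hN y
  obtain ⟨μ, hμ0, hμ⟩ := exists_pencil_factorization z hz
  have hroot : ∀ c : ℂ, ∃ a : ℂ, a ^ 2 = c := fun c => IsAlgClosed.exists_pow_nat_eq c two_pos
  -- The shift by `2` makes the block factor `t² + t⁻² - (σ² - 2)` have root `r i`.
  choose σ hσ using fun i => hroot (r i + 2)
  set κ : ℕ → ℂ := fun p => (flipMatrix N).det / ((flipMatrix (N - p)).det * (flipMatrix p).det)
    with hκ
  have hκ0 : ∀ p, κ p ≠ 0 := fun p => div_ne_zero det_flipMatrix_ne_zero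
    (mul_ne_zero det_flipMatrix_ne_zero det_flipMatrix_ne_zero)
  -- These are the required values of the products of the first `k` ratios, once the constant `κ k`
  -- is removed. The default `1` at `k = 0` is the empty product that starts the telescoping.
  set τ : ℕ → ℂ := fun k => if h : 0 < k ∧ k ≤ N / 2 then x ⟨k - 1, by omega⟩ / κ k else 1 with hτ
  have hτ0 : ∀ k, τ k ≠ 0 := by
    intro k
    simp only [hτ]
    split_ifs
    · exact div_ne_zero (hx _) (hκ0 _)
    · exact one_ne_zero
  -- Product times ratio of a pair is the square of its first entry.
  choose a ha using fun i => hroot (-(μ i * μ (N - 1 - i)) * (τ (i + 1) / τ i))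
  have ha0 : ∀ i < N, a i ≠ 0 := by
    intro i hi h
    have h1 := ha i
    rw [h, zero_pow two_ne_zero] at h1
    exact mul_ne_zero (neg_ne_zero.2 (mul_ne_zero (hμ0 i hi) (hμ0 _ (by omega))))
      (div_ne_zero (hτ0 _) (hτ0 _)) h1.symm
  set g : ℕ → ℂ := fun k => if k < N / 2 then a k else
    if N - 1 - k < N / 2 then -(μ (N - 1 - k) * μ k) / a (N - 1 - k) else μ k with hgdef
  have hg0 : ∀ i < N, g i ≠ 0 := by
    intro i hi
    simp only [hgdef]
    split_ifs
    · exact ha0 i hi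
    · exact div_ne_zero (neg_ne_zero.2 (mul_ne_zero (hμ0 _ (by omega)) (hμ0 i hi)))
        (ha0 _ (by omega))
    · exact hμ0 i hi
  have hlo : ∀ i < N / 2, g i = a i := fun i hi => by simp only [hgdef, if_pos hi]
  have hhi : ∀ i < N / 2, g (N - 1 - i) = -(μ i * μ (N - 1 - i)) / a i := fun i hi => by
    have e : N - 1 - (N - 1 - i) = i := by omega
    simp only [hgdef, e]
    rw [if_neg (by omega), if_pos hi]
  have hmid : N % 2 = 1 → g (N / 2) = μ (N / 2) := fun h => by
    simp only [hgdef]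
    rw [if_neg (by omega), if_neg (by omega)]
  have hprod : ∀ i < N / 2, g i * g (N - 1 - i) = -(μ i * μ (N - 1 - i)) := fun i hi => by
    rw [hlo i hi, hhi i hi, mul_div_cancel₀ _ (ha0 i (by omega))]
  have hratio : ∀ i < N / 2, g i / g (N - 1 - i) = τ (i + 1) / τ i := fun i hi => by
    have h1 := hμ0 i (by omega)
    have h2 := hμ0 (N - 1 - i) (by omega)
    have h3 := ha0 i (by omega)
    rw [hlo i hi, hhi i hi, div_div_eq_mul_div, ← pow_two, ha,
      mul_div_cancel_left₀ _ (neg_ne_zero.2 (mul_ne_zero h1 h2))]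
  set θ : ℕ → ℂ := fun i => μ i + μ (N - 1 - i) with hθ
  have hreg := ofMatrices_mem_regularTriples σ θ hg0
  have hG := det_crossMatrix_ne_zero θ hg0
  refine ⟨_, hreg, fun p => ?_, fun p => ?_, fun p => ?_⟩
  · set P := ofMatrices (crossMatrix N 1 σ) (crossMatrix N g θ)⁻¹ (flipMatrix N) with hP
    -- The excluded parameters are just `0` and `±i`.
    have hinf : ({t : ℂ | t ≠ 0 ∧ t + t⁻¹ ≠ 0}).Infinite := by
      have hfin : ({0, Complex.I, -Complex.I} : Set ℂ).Finite := by simp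
      refine hfin.infinite_compl.mono fun t ht => ?_
      simp only [Set.mem_compl_iff, Set.mem_insert_iff, Set.mem_singleton_iff, not_or] at ht
      refine ⟨ht.1, fun h => ?_⟩
      have h1 : (t - Complex.I) * (t + Complex.I) = 0 := by
        have ht0 := ht.1
        field_simp at h
        linear_combination h - Complex.I_sq
      rcases mul_eq_zero.1 h1 with h2 | h2
      · exact ht.2.1 (sub_eq_zero.1 h2)
      · exact ht.2.2 (eq_neg_of_add_eq_zero_left h2)
    refine congrFun (eq_of_form_expansion_eq (y := fun p => casimirY p P) hinf (fun t ht => ht.1)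
      fun t ht => ?_) p
    have h1 := det_form_expansion hN P hreg.1.2 t ht.1
    have h2 : (matA P).det = 1 := by
      rw [hP, matA_ofMatrices, det_crossMatrix]
      simp
    rw [h2, div_one, hP, matA_ofMatrices, det_form_crossMatrix hN σ t ht.1 ht.2] at h1
    simp only [hσ, add_sub_cancel_right] at h1
    rw [← hr t ht.1] at h1
    exact (add_left_cancel h1).symm
  · rw [casimirX_ofMatrices σ θ hg0, Finset.prod_congr rfl fun i hi => hratio i (by
      rw [Finset.mem_range] at hi; omega), prod_range_div_of_ne_zero hτ0]
    have h1 : τ 0 = 1 := by simp [hτ]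
    have h2 : τ ((p : ℕ) + 1) = x p / κ (p + 1) := by
      simp only [hτ]
      rw [dif_pos (by omega)]
      rfl
    rw [h1, div_one, h2]
    exact mul_div_cancel₀ _ (hκ0 _)
  · set P := ofMatrices (crossMatrix N 1 σ) (crossMatrix N g θ)⁻¹ (flipMatrix N) with hP
    refine congrFun (eq_of_pencil_expansion_eq (z := fun p => casimirZ p P) fun t => ?_) p
    have h1 := det_pencil_expansion P hreg.1.1.1 t
    have h2 := hμ t
    rw [← det_one_add_crossMatrix_mul_flipMatrix hN g μ hprod hmid] at h2
    have h3 : (matB P + t • matC P).det / (matB P).det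
        = (1 + t • (crossMatrix N g θ * flipMatrix N)).det := by
      have hu := isUnit_iff_ne_zero.2 hG
      have h4 : 1 + t • (crossMatrix N g θ * flipMatrix N)
          = crossMatrix N g θ * (matB P + t • matC P) := by
        rw [hP, matB_ofMatrices, matC_ofMatrices, mul_add, Matrix.mul_nonsing_inv _ hu,
          Matrix.mul_smul]
      rw [h4, Matrix.det_mul, hP, matB_ofMatrices, Matrix.det_nonsing_inv, Ring.inverse_eq_inv',
        div_inv_eq_mul, mul_comm]
    exact add_left_cancel (h1.symm.trans (h3.trans h2.symm))

end SpecialPoint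

/-! ### Algebraic independence and conclusion -/

theorem algebraicIndependent_casimirs {N : ℕ} (hN : 1 ≤ N) :
    AlgebraicIndependent ℂ
      (Sum.elim (fun p (x : regularTriples N) => casimirY p x)
        (Sum.elim (fun p (x : regularTriples N) => casimirX (p + 1) (label_le p) x)
          (fun p (x : regularTriples N) => casimirZ p x)) :
        Fin (N / 2) ⊕ Fin (N / 2) ⊕ Fin N → regularTriples N → ℂ) := by
  rw [algebraicIndependent_iff]
  intro P hP
  -- The product with `D` vanishes at every value vector: where `D ≠ 0` the vector is attained by a
  -- regular triple, so the relation applies there. Since the polynomial ring is a domain, `D` can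
  -- be cancelled.
  set D : MvPolynomial (Fin (N / 2) ⊕ Fin (N / 2) ⊕ Fin N) ℂ :=
    (∏ p : Fin (N / 2), MvPolynomial.X (Sum.inr (Sum.inl p)))
      * ∏ p : Fin N, MvPolynomial.X (Sum.inr (Sum.inr p)) with hD
  have hD0 : D ≠ 0 := mul_ne_zero
    (Finset.prod_ne_zero_iff.2 fun _ _ => MvPolynomial.X_ne_zero _)
    (Finset.prod_ne_zero_iff.2 fun _ _ => MvPolynomial.X_ne_zero _)
  refine (mul_eq_zero.1 (MvPolynomial.funext (p := P * D) (q := 0) fun v => ?_)).resolve_right hD0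
  rw [map_mul, map_zero]
  by_cases hv : MvPolynomial.eval v D = 0
  · rw [hv, mul_zero]
  · simp only [hD, map_mul, map_prod, MvPolynomial.eval_X, mul_ne_zero_iff,
      Finset.prod_ne_zero_iff] at hv
    obtain ⟨x, hx, hY, hX, hZ⟩ := exists_regular_point_of_values hN (fun p => v (Sum.inl p))
      (fun p => v (Sum.inr (Sum.inl p))) (fun p => v (Sum.inr (Sum.inr p)))
      (fun p => hv.1 p (Finset.mem_univ p)) (fun p _ => hv.2 p (Finset.mem_univ p))
    have h1 := congrArg (Pi.evalAlgHom ℂ (fun _ : regularTriples N => ℂ) ⟨x, hx⟩) hP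
    rw [map_zero, MvPolynomial.comp_aeval_apply] at h1
    have h2 : (fun i => Pi.evalAlgHom ℂ (fun _ : regularTriples N => ℂ) ⟨x, hx⟩
        ((Sum.elim (fun p (x : regularTriples N) => casimirY p x)
        (Sum.elim (fun p (x : regularTriples N) => casimirX (p + 1) (label_le p) x)
          (fun p (x : regularTriples N) => casimirZ p x)) :
        Fin (N / 2) ⊕ Fin (N / 2) ⊕ Fin N → regularTriples N → ℂ) i)) = v := by
      funext i
      rcases i with p | p | p
      · exact hY p
      · exact hX p
      · exact hZ p
    rw [h2] at h1
    rw [← MvPolynomial.coe_aeval_eq_eval]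
    change MvPolynomial.aeval v P * _ = 0
    rw [h1, zero_mul]

theorem theorem5p3 (N : ℕ) (hN : 1 ≤ N) :
    ∃ (Y : Fin (N / 2) → Point N → ℂ) (Z : Fin N → Point N → ℂ),
      (∀ x ∈ nondegenerateTriples N, ∀ t : ℂ, t ≠ 0 →
        (t • matA x + t⁻¹ • (matA x)ᵀ).det / (matA x).det
          = (t ^ (N : ℤ) + t ^ (-(N : ℤ)))
            + ∑ p : Fin (N / 2),
                (t ^ ((N : ℤ) - 2 * ((p : ℤ) + 1)) + t ^ (2 * ((p : ℤ) + 1) - (N : ℤ)))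
                  * Y p x) ∧
      (∀ x ∈ tripleSpace N, ∀ t : ℂ,
        (matB x + t • matC x).det / (matB x).det
          = 1 + ∑ p : Fin N, t ^ ((p : ℕ) + 1) * Z p x) ∧
      (∀ p : Fin (N / 2), IsCasimirOn (nondegenerateTriples N) (Y p)) ∧
      (∀ p : Fin (N / 2),
        IsCasimirOn (domainX N (p + 1) (label_le p)) (casimirX (p + 1) (label_le p))) ∧
      (∀ p : Fin N, IsCasimirOn (tripleSpace N) (Z p)) ∧
      AlgebraicIndependent ℂ
        (Sum.elim (fun p (x : regularTriples N) => Y p x)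
          (Sum.elim (fun p (x : regularTriples N) => casimirX (p + 1) (label_le p) x)
            (fun p (x : regularTriples N) => Z p x)) :
          Fin (N / 2) ⊕ Fin (N / 2) ⊕ Fin N → regularTriples N → ℂ) := by
  exact ⟨casimirY, casimirZ, fun x hx t ht => det_form_expansion hN x hx.2 t ht,
    fun x hx t => det_pencil_expansion x hx.1 t, isCasimirOn_casimirY,
    fun p => isCasimirOn_casimirX _ _, isCasimirOn_casimirZ, algebraicIndependent_casimirs hN⟩
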